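/- Let $\Omega\subset\mathbb R^2$ be a bounded Lipschitz domain (open, connected, non-empty), let $K\subset\Omega$ be a Lebesgue measurable set of positive measure, let $t>1$, $\lambda>0$ and $f\in L^t(K)$. Let $\mathbb R^{2\times2}_{sym,+}$ be the set of symmetric positive definite real $2\times2$ matrices, let $C^0(\overline\Omega,\mathbb R^{2\times2}_{sym,+})$ carry the topology of uniform convergence, and for $R>0$ put $$B_R^K:=\{w\in W^{1,2}(\Omega):\ \|w\|_{L^t(K)}\le R\}.$$ Then there is a number $R_0>0$, which depends only on $\Omega,K,t,\lambda,f$, such that the following holds. Let $D: W^{1,2}(\Omega)\to C^0(\overline\Omega,\mathbb R^{2\times2}_{sym,+})$ be a continuous mapping such that for every $R>0$ the set $D(B_R^K)$ is precompact in $C^0(\overline\Omega,\mathbb R^{2\times2}_{sym,+})$, i.e. its closure in this space is compact. Then for every $w\in W^{1,2}(\Omega)$ the functional $$v\mapsto J[w,v]:=\frac12\int_\Omega D(w)\nabla v\cdot\nabla v\,dx+\lambda\int_K|v-f|^t\,dx$$ has exactly one minimizer $T(w)$ in $W^{1,2}(\Omega)$, and for every $R\ge R_0$ the resulting mapping $T:W^{1,2}(\Omega)\to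 W^{1,2}(\Omega)$ has at least one fixed point in $B_R^K$. -/

import Mathlib

open MeasureTheory Set

open scoped ENNReal ContDiff

noncomputable section

/-- The Euclidean plane `ℝ²`. -/
abbrev Plane : Type := EuclideanSpace ℝ (Fin 2)

/-- `Ω` is a bounded Lipschitz domain in the plane: a bounded (non-empty) connected open set which,
near each boundary point and in suitable orthonormal coordinates, is the region strictly above the
graph of a Lipschitz function. -/
structure IsBoundedLipschitzDomain (Ω : Set Plane) : Prop where
  isOpen : IsOpen Ω
  isConnected : IsConnected Ω
  isBounded : Bornology.IsBounded Ω
  lipschitz_boundary : ∀ p ∈ frontier Ω, ∃ (A : Plane ≃ₗᵢ[ℝ] Plane) (L : NNReal) (γ : ℝ → ℝ) (r : ℝ),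
    LipschitzWith L γ ∧ 0 < r ∧
      Ω ∩ Metric.ball p r = {x ∈ Metric.ball p r | γ (A x 0) < A x 1}

/-- `g` is a weak gradient of `u` in `Ω`: `∫_Ω u ∂ᵢφ = - ∫_Ω gᵢ φ` for `i = 1, 2` and every test
function `φ ∈ C_c^∞(Ω)`. -/
def IsWeakGradient (Ω : Set Plane) (u : Plane → ℝ) (g : Plane → Plane) : Prop :=
  ∀ φ : Plane → ℝ, ContDiff ℝ ∞ φ → HasCompactSupport φ → tsupport φ ⊆ Ω → ∀ i : Fin 2,
    ∫ x in Ω, u x * fderiv ℝ φ x (EuclideanSpace.single i 1) = - ∫ x in Ω, g x i * φ x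

section helpers

variable {Ω : Set Plane} {φ : Plane → ℝ}

theorem integrable_mul_partial (u : Lp ℝ 2 (volume.restrict Ω)) (hφ : ContDiff ℝ ∞ φ)
    (hc : HasCompactSupport φ) (i : Fin 2) :
    Integrable (fun x => u x * fderiv ℝ φ x (EuclideanSpace.single i 1)) (volume.restrict Ω) := by
  have h1 : Continuous fun x => fderiv ℝ φ x (EuclideanSpace.single i 1) :=
    (hφ.continuous_fderiv (by simp)).clm_apply continuous_const
  have h2 : HasCompactSupport fun x => fderiv ℝ φ x (EuclideanSpace.single i 1) :=
    hc.fderiv_apply ℝ _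
  exact (Lp.memLp u).integrable_mul (q := 2) (h1.memLp_of_hasCompactSupport h2)

theorem integrable_coord_mul (g : Lp Plane 2 (volume.restrict Ω)) (hφ : ContDiff ℝ ∞ φ)
    (hc : HasCompactSupport φ) (i : Fin 2) :
    Integrable (fun x => g x i * φ x) (volume.restrict Ω) := by
  have h : MemLp (fun x => g x i) 2 (volume.restrict Ω) :=
    (EuclideanSpace.proj i : Plane →L[ℝ] ℝ).comp_memLp' (Lp.memLp g)
  exact h.integrable_mul (q := 2) (hφ.continuous.memLp_of_hasCompactSupport hc)

end helpers

/-- The Sobolev space `W^{1,2}(Ω)`: all pairs `(u, ∇u)` with `u ∈ L²(Ω)` whose weak gradient `∇u`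
exists in `L²(Ω; ℝ²)` (it is determined by `u`). The norm it inherits from the `ℓ²`-product is the
Sobolev norm `(‖u‖²_{L²} + ‖∇u‖²_{L²})^{1/2}`. -/
def sobolevSubmodule (Ω : Set Plane) :
    Submodule ℝ (WithLp 2 (Lp ℝ 2 (volume.restrict Ω) × Lp Plane 2 (volume.restrict Ω))) where
  carrier := {p | IsWeakGradient Ω p.fst p.snd}
  zero_mem' := by
    intro φ _ _ _ i
    have h1 : ∫ x in Ω, (0 : Lp ℝ 2 (volume.restrict Ω)) x *
        fderiv ℝ φ x (EuclideanSpace.single i 1) = 0 := by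
      rw [integral_eq_zero_of_ae]
      filter_upwards [Lp.coeFn_zero ℝ 2 (volume.restrict Ω)] with x hx
      rw [hx]
      simp
    have h2 : ∫ x in Ω, (0 : Lp Plane 2 (volume.restrict Ω)) x i * φ x = 0 := by
      rw [integral_eq_zero_of_ae]
      filter_upwards [Lp.coeFn_zero Plane 2 (volume.restrict Ω)] with x hx
      rw [hx]
      simp
    simp only [WithLp.zero_fst, WithLp.zero_snd]
    rw [h1, h2, neg_zero]
  add_mem' := by
    intro p q hp hq φ hφ hc hs i
    have h1 : ∫ x in Ω, (p.fst + q.fst) x * fderiv ℝ φ x (EuclideanSpace.single i 1)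
        = (∫ x in Ω, p.fst x * fderiv ℝ φ x (EuclideanSpace.single i 1))
          + ∫ x in Ω, q.fst x * fderiv ℝ φ x (EuclideanSpace.single i 1) := by
      rw [← integral_add (integrable_mul_partial _ hφ hc i) (integrable_mul_partial _ hφ hc i)]
      refine integral_congr_ae ?_
      filter_upwards [Lp.coeFn_add p.fst q.fst] with x hx
      rw [hx, Pi.add_apply, add_mul]
    have h2 : ∫ x in Ω, (p.snd + q.snd) x i * φ x
        = (∫ x in Ω, p.snd x i * φ x) + ∫ x in Ω, q.snd x i * φ x := by
      rw [← integral_add (integrable_coord_mul _ hφ hc i) (integrable_coord_mul _ hφ hc i)]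
      refine integral_congr_ae ?_
      filter_upwards [Lp.coeFn_add p.snd q.snd] with x hx
      rw [hx, Pi.add_apply, PiLp.add_apply, add_mul]
    simp only [WithLp.add_fst, WithLp.add_snd]
    rw [h1, h2, hp φ hφ hc hs i, hq φ hφ hc hs i, neg_add]
  smul_mem' := by
    intro c p hp φ hφ hc hs i
    have h1 : ∫ x in Ω, (c • p.fst) x * fderiv ℝ φ x (EuclideanSpace.single i 1)
        = c * ∫ x in Ω, p.fst x * fderiv ℝ φ x (EuclideanSpace.single i 1) := by
      rw [← integral_const_mul]
      refine integral_congr_ae ?_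
      filter_upwards [Lp.coeFn_smul c p.fst] with x hx
      rw [hx, Pi.smul_apply, smul_eq_mul, mul_assoc]
    have h2 : ∫ x in Ω, (c • p.snd) x i * φ x = c * ∫ x in Ω, p.snd x i * φ x := by
      rw [← integral_const_mul]
      refine integral_congr_ae ?_
      filter_upwards [Lp.coeFn_smul c p.snd] with x hx
      rw [hx, Pi.smul_apply, PiLp.smul_apply, smul_eq_mul, mul_assoc]
    simp only [WithLp.smul_fst, WithLp.smul_snd]
    rw [h1, h2, hp φ hφ hc hs i, mul_neg]

/-- The normed space `W^{1,2}(Ω)`. -/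
abbrev W12 (Ω : Set Plane) : Type := sobolevSubmodule Ω

/-- The function underlying an element of `W^{1,2}(Ω)`. -/
def W12.val {Ω : Set Plane} (u : W12 Ω) : Lp ℝ 2 (volume.restrict Ω) := u.1.fst

/-- The weak gradient of an element of `W^{1,2}(Ω)`. -/
def W12.grad {Ω : Set Plane} (u : W12 Ω) : Lp Plane 2 (volume.restrict Ω) := u.1.snd

/-- The symmetric positive definite real `2 × 2` matrices. -/
abbrev SymPosMatrix : Type := {A : Matrix (Fin 2) (Fin 2) ℝ // A.PosDef}

/-- `C⁰(Ω̄; ℝ^{2×2}_{sym,+})`. For bounded `Ω` the closure is compact, so that the compact-open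
topology that this type carries is the topology of uniform convergence. -/
abbrev TensorField (Ω : Set Plane) : Type := C(closure Ω, SymPosMatrix)

open scoped Classical in
/-- The values of a tensor field on `Ω̄`, extended by zero to the plane. -/
def TensorField.eval {Ω : Set Plane} (A : TensorField Ω) (x : Plane) : Matrix (Fin 2) (Fin 2) ℝ :=
  if h : x ∈ closure Ω then (A ⟨x, h⟩).1 else 0

/-- The data ball `{w ∈ W^{1,2}(Ω) : ‖w‖_{L^t(K)} ≤ R}`. -/
def dataBall (Ω K : Set Plane) (t R : ℝ) : Set (W12 Ω) :=
  {w | eLpNorm w.val (ENNReal.ofReal t) (volume.restrict K) ≤ ENNReal.ofReal R}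

/-- The functional `½ ∫_Ω D(w)∇v·∇v dx + lam ∫_K |v - f|^t dx`. Both integrands are non-negative,
so that both integrals are taken in `[0, ∞]`. -/
def energy {Ω : Set Plane} (K : Set Plane) (t lam : ℝ) (f : Plane → ℝ) (D : W12 Ω → TensorField Ω)
    (w v : W12 Ω) : ℝ≥0∞ :=
  (1 / 2) * (∫⁻ x in Ω, ENNReal.ofReal
      (dotProduct (((D w).eval x).mulVec (v.grad x).ofLp) (v.grad x).ofLp))
    + ENNReal.ofReal lam * ∫⁻ x in K, ENNReal.ofReal (|v.val x - f x| ^ t)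

end

/-! For a fixed tensor field `A` let `S A` minimize the energy with coefficients `A`; then `T = S ∘
D`. Comparison with the competitor 0 gives `‖S A - f‖ ≤ ‖f‖` in `L^t(K)`, hence `‖S A‖ ≤ 2‖f‖`,
whatever `A` is. So for `R ≥ R₀ = 2‖f‖ + 1` the map `T` sends all of `W^{1,2}(Ω)` into the convex
set `dataBall Ω K t R`. That set need not be bounded in `W^{1,2}(Ω)`, but `D` makes it precompact
and `S` is continuous, so its image under `T` is precompact and Schauder's theorem applies.

Existence, uniqueness and continuity of `S` rest on one estimate: by the parallelogram law for the
Dirichlet term and convexity of `|·|^t`, the energy at a midpoint lies below the mean of the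
energies by at least a multiple of `‖∇(u - v)‖²`. Hence the gradients of a minimizing sequence are
Cauchy. By Poincaré–Wirtinger (`exists_norm_sub_smul_le`) so are the functions modulo constants, and
the fidelity term on `K` bounds the constants. A subsequence converges in norm, and Fatou's lemma
shows that the limit is a minimizer; weak convergence never enters. Two minimizers have equal
gradients, so they differ by a constant, which vanishes by strict convexity of `|·|^t` on `K`. A
tensor field near `A` has a quadratic form comparable to that of `A` with factor near 1, so its
minimizer almost minimizes the energy of `A` and is therefore close to `S A`
(`continuous_minimizer`).

Poincaré–Wirtinger comes from the `L²` translation estimate: it is proved on a ball by averaging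
over pairs of points, spread through `Ω` by connectedness, and carried to the boundary by shifting
inwards along the Lipschitz graphs. Schauder's theorem is reduced to Brouwer's by finite nets, and
Brouwer's to the absence of smooth retractions onto a sphere. -/

/-! ### Brouwer's theorem by change of variables -/

section Brouwer

open Metric Topology

/-- A perturbation of the identity by a contraction is bijective. -/
theorem bijective_id_add_of_lipschitz {E : Type*} [NormedAddCommGroup E] [CompleteSpace E]
    {k : E → E} {c : NNReal} (hc : c < 1)
    (hk : LipschitzWith c k) : Function.Bijective fun x => x + k x := by
  constructor
  · intro x y hxy
    simp only at hxy
    by_contra hne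
    have h1 : dist x y = dist (k x) (k y) := by
      rw [dist_eq_norm, dist_eq_norm, ← norm_neg (k x - k y)]
      congr 1
      have := sub_eq_zero.2 hxy
      rw [← sub_eq_zero, ← this]
      abel
    have h2 := hk.dist_le_mul x y
    have h3 : 0 < dist x y := dist_pos.2 hne
    have h4 : (c : ℝ) < 1 := hc
    nlinarith
  · intro y
    have hcon : ContractingWith c fun x => y - k x := by
      refine ⟨hc, LipschitzWith.of_dist_le_mul fun a b => ?_⟩
      rw [dist_sub_left]
      exact hk.dist_le_mul a b
    refine ⟨ContractingWith.fixedPoint _ hcon, ?_⟩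
    have : y - k _ = _ := hcon.fixedPoint_isFixedPt
    simp only
    nth_rewrite 1 [← this]
    abel

variable {E : Type*} [NormedAddCommGroup E] [InnerProductSpace ℝ E]

/-- The degree bound is uniform in `A`, so values at fixed small parameters determine `det (1 + A)`
by one interpolation formula valid for all `A`. -/
theorem exists_polynomial_eval_eq_det [FiniteDimensional ℝ E] (A : E →L[ℝ] E) :
    ∃ P : Polynomial ℝ, P.natDegree ≤ Module.finrank ℝ E ∧ ∀ t : ℝ, P.eval t = (1 + t • A).det := by
  classical
  let b := Module.finBasis ℝ E
  let M := LinearMap.toMatrix b b (A : E →ₗ[ℝ] E)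
  refine ⟨((Polynomial.X : Polynomial ℝ) • M.map (Polynomial.C : ℝ →+* Polynomial ℝ) +
    (1 : Matrix (Fin (Module.finrank ℝ E)) (Fin (Module.finrank ℝ E)) ℝ).map
      (Polynomial.C : ℝ →+* Polynomial ℝ)).det, ?_, fun t => ?_⟩
  · simpa using Polynomial.natDegree_det_X_add_C_le M 1
  · rw [← Polynomial.coe_evalRingHom, RingHom.map_det]
    change _ = LinearMap.det ((1 + t • A : E →L[ℝ] E) : E →ₗ[ℝ] E)
    rw [← LinearMap.det_toMatrix b]
    congr 1
    have h1 : LinearMap.toMatrix b b ((1 + t • A : E →L[ℝ] E) : E →ₗ[ℝ] E) = 1 + t • M := by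
      have : ((1 + t • A : E →L[ℝ] E) : E →ₗ[ℝ] E) = LinearMap.id + t • (A : E →ₗ[ℝ] E) := rfl
      rw [this, map_add, map_smul, LinearMap.toMatrix_id]
    rw [h1]
    ext i j
    by_cases hij : i = j
    · subst hij
      simp [add_comm]
      ring
    · simp [hij]
      ring

/-- Extending a Lipschitz function on a closed ball, which vanishes on the sphere, by zero. -/
theorem lipschitzWith_indicator_closedBall {R : ℝ} {h : E → E} {L : NNReal}
    (hL : LipschitzOnWith L h (closedBall 0 R)) (h0 : ∀ x, ‖x‖ = R → h x = 0) :
    LipschitzWith L ((closedBall (0 : E) R).indicator h) := by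
  have key : ∀ x y : E, x ∈ closedBall (0 : E) R → y ∉ closedBall (0 : E) R →
      dist (h x) 0 ≤ L * dist x y := by
    intro x y hx hy
    simp only [mem_closedBall, dist_zero_right, not_le] at hx hy
    have hc : ContinuousOn (fun s : ℝ => ‖AffineMap.lineMap x y s‖) (Icc 0 1) := by
      fun_prop
    have : R ∈ (fun s : ℝ => ‖(AffineMap.lineMap x y s : E)‖) '' Icc 0 1 := by
      apply intermediate_value_Icc zero_le_one hc
      simp [hx, hy.le]
    obtain ⟨s, hs, hsR⟩ := this
    simp only at hsR
    set z : E := AffineMap.lineMap x y s with hz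
    calc dist (h x) 0 = dist (h x) (h z) := by rw [h0 z hsR]
      _ ≤ L * dist x z := hL.dist_le_mul x (by simpa using hx) z (by simp [hsR])
      _ ≤ L * dist x y := by
        gcongr
        rw [hz, dist_left_lineMap, Real.norm_of_nonneg hs.1]
        exact mul_le_of_le_one_left dist_nonneg hs.2
  refine LipschitzWith.of_dist_le_mul fun x y => ?_
  by_cases hx : x ∈ closedBall (0 : E) R <;> by_cases hy : y ∈ closedBall (0 : E) R
  · rw [indicator_of_mem hx, indicator_of_mem hy]
    exact hL.dist_le_mul x hx y hy
  · rw [indicator_of_mem hx, indicator_of_notMem hy]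
    exact key x y hx hy
  · rw [indicator_of_mem hy, indicator_of_notMem hx, dist_comm, dist_comm x y]
    exact key y x hy hx
  · rw [indicator_of_notMem hx, indicator_of_notMem hy, dist_self]
    positivity

variable [FiniteDimensional ℝ E] [MeasurableSpace E] [BorelSpace E]

/-- If `h` is smooth and vanishes on a sphere, then `∫ det (1 + h')` over the ball is the volume of
the ball. -/
theorem integral_det_one_add_fderiv {R : ℝ} {h : E → E} (hh : ContDiff ℝ ∞ h)
    (h0 : ∀ x, ‖x‖ = R → h x = 0) :
    ∫ x in ball (0 : E) R, (1 + fderiv ℝ h x).det = volume.real (ball (0 : E) R) := by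
  have hcont : Continuous (fderiv ℝ h) := hh.continuous_fderiv (by simp)
  obtain ⟨L, hL⟩ : ∃ L : NNReal, ∀ x ∈ closedBall (0 : E) R, ‖fderiv ℝ h x‖₊ ≤ L := by
    obtain ⟨C, hC⟩ := (isCompact_closedBall (0 : E) R).exists_bound_of_continuousOn hcont.continuousOn
    refine ⟨C.toNNReal, fun x hx => ?_⟩
    rw [← NNReal.coe_le_coe]
    exact (hC x hx).trans (Real.le_coe_toNNReal C)
  have hdiff : Differentiable ℝ h := hh.differentiable (by simp)
  have hLip : LipschitzOnWith L h (closedBall 0 R) :=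
    Convex.lipschitzOnWith_of_nnnorm_fderiv_le (fun x _ => hdiff x) hL (convex_closedBall _ _)
  have hk := lipschitzWith_indicator_closedBall hLip h0
  set k := (closedBall (0 : E) R).indicator h with hkdef
  obtain ⟨δ, hδ, hdet⟩ : ∃ δ > 0, ∀ A : E →L[ℝ] E, dist A 1 < δ → 0 < A.det := by
    have : ∀ᶠ A : E →L[ℝ] E in 𝓝 1, 0 < A.det := by
      have h1 : (1 : E →L[ℝ] E).det = 1 := LinearMap.det_id
      refine (ContinuousLinearMap.continuous_det (𝕜 := ℝ) (E := E)).continuousAt.eventually_const_lt ?_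
      change 0 < (1 : E →L[ℝ] E).det
      rw [h1]
      exact one_pos
    obtain ⟨δ, hδ, h⟩ := Metric.eventually_nhds_iff.1 this
    exact ⟨δ, hδ, fun A hA => h hA⟩
  -- `t₀ * L < δ` keeps the determinants positive, so that absolute values can be dropped; `t₀ * L <
  -- 1` makes the perturbation of the identity a contraction.
  obtain ⟨t₀, ht₀, ht₀δ, ht₀1⟩ : ∃ t₀ : ℝ, 0 < t₀ ∧ t₀ * L < δ ∧ t₀ * L < 1 := by
    have hL1 : (0 : ℝ) < L + 1 := by positivity
    refine ⟨min δ 1 / (L + 1), by positivity, ?_, ?_⟩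
    · have : min δ 1 / (L + 1) * L < min δ 1 := by
        rw [div_mul_eq_mul_div, div_lt_iff₀ hL1]
        have : 0 < min δ 1 := by positivity
        nlinarith
      exact this.trans_le (min_le_left _ _)
    · have : min δ 1 / (L + 1) * L < min δ 1 := by
        rw [div_mul_eq_mul_div, div_lt_iff₀ hL1]
        have : 0 < min δ 1 := by positivity
        nlinarith
      exact this.trans_le (min_le_right _ _)
  -- For small `t` the map `x + t • k x` is a bijection of the space that fixes every point outside
  -- the ball, so it maps the ball onto itself, and the integral of its Jacobian is the volume.
  have small : ∀ t : ℝ, 0 < t → t ≤ t₀ →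
      ∫ x in ball (0 : E) R, (1 + t • fderiv ℝ h x).det = volume.real (ball (0 : E) R) := by
    intro t ht htt
    have htL : t * L < 1 := (mul_le_mul_of_nonneg_right htt L.2).trans_lt ht₀1
    have hlip : LipschitzWith (t.toNNReal * L) (fun x => t • k x) := by
      refine LipschitzWith.of_dist_le_mul fun x y => ?_
      rw [dist_smul₀, Real.norm_of_nonneg ht.le, NNReal.coe_mul, Real.coe_toNNReal t ht.le, mul_assoc]
      exact mul_le_mul_of_nonneg_left (hk.dist_le_mul x y) ht.le
    have hbij := bijective_id_add_of_lipschitz (c := t.toNNReal * L) (by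
      rw [← NNReal.coe_lt_coe, NNReal.coe_mul, Real.coe_toNNReal t ht.le]; exact htL) hlip
    have hout : ∀ x : E, x ∉ ball (0 : E) R → x + t • k x = x := by
      intro x hx
      have : k x = 0 := by
        rw [hkdef]
        by_cases hx' : x ∈ closedBall (0 : E) R
        · rw [indicator_of_mem hx']
          apply h0
          simp only [mem_ball, mem_closedBall, dist_zero_right] at hx hx'
          linarith
        · rw [indicator_of_notMem hx']
      rw [this, smul_zero, add_zero]
    have himg : (fun x => x + t • k x) '' ball 0 R = ball 0 R := by
      apply Subset.antisymm
      · rintro _ ⟨x, hx, rfl⟩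
        by_contra hy
        have := hbij.1 (a₁ := x + t • k x) (a₂ := x) (hout _ hy)
        rw [← this] at hx
        exact hy hx
      · intro y hy
        obtain ⟨x, rfl⟩ := hbij.2 y
        refine ⟨x, ?_, rfl⟩
        by_contra hx
        simp only [hout x hx] at hy
        exact hx hy
    have hder : ∀ x ∈ ball (0 : E) R,
        HasFDerivWithinAt (fun x => x + t • k x) (1 + t • fderiv ℝ h x) (ball 0 R) x := by
      intro x hx
      have h1 : HasFDerivAt (fun x => x + t • h x) (1 + t • fderiv ℝ h x) x :=
        (hasFDerivAt_id x).add ((hdiff x).hasFDerivAt.const_smul t)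
      refine h1.hasFDerivWithinAt.congr (fun y hy => ?_) ?_
      · rw [hkdef, indicator_of_mem (ball_subset_closedBall hy)]
      · rw [hkdef, indicator_of_mem (ball_subset_closedBall hx)]
    have hvol := integral_image_eq_integral_abs_det_fderiv_smul volume measurableSet_ball hder
      hbij.1.injOn (fun _ => (1 : ℝ))
    rw [himg] at hvol
    have hpos : ∀ x ∈ ball (0 : E) R, |(1 + t • fderiv ℝ h x).det| = (1 + t • fderiv ℝ h x).det := by
      intro x hx
      apply abs_of_pos
      apply hdet
      rw [dist_eq_norm, add_sub_cancel_left, norm_smul, Real.norm_of_nonneg ht.le]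
      have : ‖fderiv ℝ h x‖ ≤ L := hL x (ball_subset_closedBall hx)
      calc t * ‖fderiv ℝ h x‖ ≤ t₀ * L := by gcongr
        _ < δ := ht₀δ
    simp only [smul_eq_mul, mul_one] at hvol
    rw [setIntegral_congr_fun measurableSet_ball hpos] at hvol
    rw [← hvol, setIntegral_const, smul_eq_mul, mul_one]
  -- the integrand is a polynomial in the parameter, hence determined by finitely many small values
  classical
  set n := Module.finrank ℝ E
  let s := Finset.range (n + 1)
  let v : ℕ → ℝ := fun i => t₀ / (i + 1)
  have hv : InjOn v s := by
    intro i _ j _ hij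
    simp only [v] at hij
    have hi : (0 : ℝ) < i + 1 := by positivity
    have hj : (0 : ℝ) < j + 1 := by positivity
    rw [div_eq_div_iff hi.ne' hj.ne'] at hij
    have := mul_left_cancel₀ ht₀.ne' hij
    exact_mod_cast (by linarith : (i : ℝ) = j)
  have hinterp : ∀ x, (1 + fderiv ℝ h x).det =
      ∑ i ∈ s, (1 + v i • fderiv ℝ h x).det * (Lagrange.basis s v i).eval 1 := by
    intro x
    obtain ⟨P, hPdeg, hP⟩ := exists_polynomial_eval_eq_det (fderiv ℝ h x)
    have := Lagrange.eq_interpolate (f := P) hv (by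
      rw [Finset.card_range]
      refine (Polynomial.degree_le_natDegree).trans_lt ?_
      exact_mod_cast Nat.lt_succ_of_le hPdeg)
    have h1 := hP 1
    rw [one_smul] at h1
    rw [← h1, this, Lagrange.interpolate_apply, Polynomial.eval_finsetSum]
    simp only [Polynomial.eval_mul, Polynomial.eval_C, hP]
  have hbasis : ∑ i ∈ s, (Lagrange.basis s v i).eval 1 = 1 := by
    rw [← Polynomial.eval_finsetSum, Lagrange.sum_basis hv ⟨0, by simp [s]⟩, Polynomial.eval_one]
  simp_rw [hinterp]
  rw [integral_finsetSum]
  · have : ∀ i ∈ s, ∫ x in ball (0 : E) R,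
        (1 + v i • fderiv ℝ h x).det * (Lagrange.basis s v i).eval 1 =
        volume.real (ball (0 : E) R) * (Lagrange.basis s v i).eval 1 := by
      intro i _
      rw [integral_mul_const, small (v i) (by simp only [v]; positivity)]
      exact div_le_self ht₀.le (by linarith [(Nat.cast_nonneg i : (0 : ℝ) ≤ i)])
    rw [Finset.sum_congr rfl this, ← Finset.mul_sum, hbasis, mul_one]
  · intro i _
    apply Integrable.mul_const
    have hc : Continuous fun x => (1 + v i • fderiv ℝ h x).det :=
      ContinuousLinearMap.continuous_det.comp (by fun_prop)
    exact (hc.continuousOn.integrableOn_compact (isCompact_closedBall 0 R)).mono_set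
      ball_subset_closedBall

/-- There is no smooth map of a ball to its boundary sphere which is the identity on the sphere. -/
theorem not_exists_smooth_retraction {R : ℝ} (hR : 0 < R) {r : E → E} (hr : ContDiff ℝ ∞ r)
    (hsphere : ∀ x, ‖x‖ = R → r x = x) (hnorm : ∀ x, ‖r x‖ = R) : False := by
  have hI := integral_det_one_add_fderiv (R := R) (h := fun x => r x - x) (hr.sub contDiff_id)
    (fun x hx => by rw [hsphere x hx, sub_self])
  have hdr : Differentiable ℝ r := hr.differentiable (by simp)
  -- Were the derivative of `r` invertible at `x`, it would take some `v` to `r x`; then `‖r‖ ^ 2`,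
  -- which is constant, would have derivative `2 * R ^ 2 ≠ 0` in the direction `v`.
  have hdet : ∀ x, (1 + fderiv ℝ (fun x => r x - x) x).det = 0 := by
    intro x
    have h1 : 1 + fderiv ℝ (fun x => r x - x) x = fderiv ℝ r x := by
      have := (hdr x).hasFDerivAt.sub (hasFDerivAt_id x)
      have h2 : fderiv ℝ (fun x => r x - x) x = fderiv ℝ r x - 1 := this.fderiv
      rw [h2]; abel
    rw [h1]
    by_contra hne
    have hunit : IsUnit (fderiv ℝ r x : E →ₗ[ℝ] E) := (LinearMap.isUnit_iff_isUnit_det _).2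
      (isUnit_iff_ne_zero.2 hne)
    obtain ⟨v, hv⟩ := ((Module.End.isUnit_iff _).1 hunit).2 (r x)
    have h2 : HasFDerivAt (fun y => ‖r y‖ ^ 2) (2 • (innerSL ℝ (r x)).comp (fderiv ℝ r x)) x :=
      (hdr x).hasFDerivAt.norm_sq
    have h3 : HasFDerivAt (fun y => ‖r y‖ ^ 2) (0 : E →L[ℝ] ℝ) x := by
      simp_rw [hnorm]
      exact hasFDerivAt_const _ _
    have h4 := congrArg (fun A : E →L[ℝ] ℝ => A v) (h2.unique h3)
    have hv' : fderiv ℝ r x v = r x := hv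
    simp [hv', hnorm, hR.ne'] at h4
  simp_rw [hdet] at hI
  rw [integral_zero] at hI
  have : 0 < volume.real (ball (0 : E) R) :=
    ENNReal.toReal_pos (measure_ball_pos _ _ hR).ne' measure_ball_lt_top.ne
  linarith

/-- **Brouwer's fixed point theorem**, for maps of a Euclidean space to its unit ball. -/
theorem exists_fixedPoint_of_continuous_of_norm_le_one {f : E → E} (hf : Continuous f)
    (hf1 : ∀ x, ‖f x‖ ≤ 1) : ∃ x, f x = x := by
  by_contra! hne
  -- The cutoff is 1 on the unit ball and 0 beyond radius 2. A zero of `q` satisfies `x = χ x • f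
  -- x`, so it lies in the unit ball and is a fixed point of `f`.
  let χ : E → ℝ := fun x => max 0 (min 1 (2 - ‖x‖))
  have hχc : Continuous χ := by fun_prop
  let q : E → E := fun x => x - χ x • f x
  have hqc : Continuous q := by fun_prop
  have hq2 : ∀ x : E, 2 ≤ ‖x‖ → q x = x := by
    intro x hx
    have : χ x = 0 := by
      simp only [χ]
      rw [max_eq_left]
      exact (min_le_right _ _).trans (by linarith)
    simp [q, this]
  have hq0 : ∀ x, q x ≠ 0 := by
    intro x hx
    have hx' : x = χ x • f x := sub_eq_zero.1 hx
    have hχ0 : 0 ≤ χ x := le_max_left _ _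
    have hχ1 : χ x ≤ 1 := max_le zero_le_one (min_le_left _ _)
    by_cases h1 : ‖x‖ ≤ 1
    · have : χ x = 1 := by
        simp only [χ]
        rw [min_eq_left (by linarith), max_eq_right zero_le_one]
      rw [this, one_smul] at hx'
      exact hne x hx'.symm
    · have : ‖x‖ ≤ 1 := by
        rw [hx', norm_smul, Real.norm_of_nonneg hχ0]
        exact mul_le_one₀ hχ1 (norm_nonneg _) (hf1 x)
      exact h1 this
  have hU : {x : E | 2 < ‖x‖} ∈ 𝓝ˢ {x : E | 3 ≤ ‖x‖} := by
    refine (isOpen_lt continuous_const continuous_norm).mem_nhdsSet.2 fun x hx => ?_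
    simp only [mem_ofPred_eq] at hx ⊢
    linarith
  -- An error below `‖q x‖` keeps `g` away from zero, and `g` agrees with `q`, hence with the
  -- identity, from radius 3 on. Normalizing `g` gives a retraction onto the sphere of radius 3.
  obtain ⟨g, hg, hgd, hgS, -⟩ := hqc.exists_contDiff_approx_and_eqOn (ε := fun x => ‖q x‖) ⊤
    (by fun_prop) (fun x => norm_pos_iff.2 (hq0 x)) (isClosed_le continuous_const continuous_norm) hU
    (contDiffOn_id.congr fun x hx => hq2 x (le_of_lt hx))
  have hg0 : ∀ x, g x ≠ 0 := by
    intro x hx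
    have := hgd x
    rw [hx, dist_zero_left] at this
    exact lt_irrefl _ this
  have hg3 : ∀ x : E, ‖x‖ = 3 → g x = x := by
    intro x hx
    rw [hgS (show x ∈ {x : E | 3 ≤ ‖x‖} from hx.ge)]
    exact hq2 x (by linarith)
  refine not_exists_smooth_retraction (R := 3) (r := fun x => (3 / ‖g x‖) • g x) (by norm_num)
    ((contDiff_const.div (hg.norm ℝ hg0) fun x => norm_ne_zero_iff.2 (hg0 x)).smul hg) ?_ ?_
  · intro x hx
    simp [hg3 x hx, hx]
  · intro x
    have := norm_pos_iff.2 (hg0 x)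
    rw [norm_smul, norm_div, norm_norm, div_mul_cancel₀ _ this.ne']
    norm_num

end Brouwer

/-! ### Schauder's theorem by finite nets -/

section Schauder

open Metric Topology Filter

variable {H : Type*} [NormedAddCommGroup H] [NormedSpace ℝ H]

/-- A continuous self-map of a convex set with precompact image moves some point arbitrarily
little. -/
theorem exists_dist_le_of_isCompact_closure_image {T : H → H} {B : Set H} (hT : Continuous T)
    (hB : Convex ℝ B) (hBne : B.Nonempty) (hTB : MapsTo T B B) (hc : IsCompact (closure (T '' B)))
    {ε : ℝ} (hε : 0 < ε) : ∃ x ∈ B, dist (T x) x ≤ ε := by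
  classical
  obtain ⟨b₀, hb₀⟩ := hBne
  obtain ⟨s, hsB, hs, hcov⟩ := finite_approx_of_totallyBounded
    (hc.totallyBounded.subset subset_closure) ε hε
  have : Fintype s := hs.fintype
  -- Dividing by `σ` keeps the total weight at most 1, and `b₀` receives the rest. So `p` is
  -- continuous from the whole space into `B`, and on the standard simplex it is the barycentric map
  -- of the net.
  let σ : EuclideanSpace ℝ s → ℝ := fun a => max 1 (∑ i, max (a i) 0)
  have hσ1 : ∀ a, 1 ≤ σ a := fun a => le_max_left _ _
  let p : EuclideanSpace ℝ s → H := fun a =>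
    (1 - ∑ i, max (a i) 0 / σ a) • b₀ + ∑ i, (max (a i) 0 / σ a) • (i : H)
  have hσc : Continuous σ := by fun_prop
  have hpc : Continuous p := by
    have h : ∀ i : s, Continuous fun a : EuclideanSpace ℝ s => max (a i) 0 / σ a := fun i =>
      Continuous.div (by fun_prop) hσc fun a => (one_pos.trans_le (hσ1 a)).ne'
    fun_prop
  have hpB : ∀ a, p a ∈ B := by
    intro a
    have hσ0 := one_pos.trans_le (hσ1 a)
    have := hB.sum_mem (t := (Finset.univ : Finset (Option s)))
      (w := fun o => o.elim (1 - ∑ i, max (a i) 0 / σ a) fun i => max (a i) 0 / σ a)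
      (z := fun o => o.elim b₀ fun i => (i : H)) ?_ ?_ ?_
    · simpa [Fintype.sum_option] using this
    · rintro (_ | i) _
      · simp only [Option.elim, sub_nonneg]
        rw [← Finset.sum_div, div_le_one hσ0]
        exact le_max_right _ _
      · simp only [Option.elim]
        positivity
    · simp [Fintype.sum_option]
    · rintro (_ | i) _
      · exact hb₀
      · obtain ⟨x, hx, hxi⟩ := hsB i.2
        simp only [Option.elim, ← hxi]
        exact hTB hx
  -- The weight `m i z` vanishes unless `z` is within `ε` of `i`. At a fixed point of the normalized
  -- weights, `T (p a) - p a` is thus a convex combination of vectors of norm at most `ε`.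
  let m : s → H → ℝ := fun i z => max (ε - dist z i) 0
  let M : H → ℝ := fun z => ∑ i, m i z
  have hm0 : ∀ i z, 0 ≤ m i z := fun i z => le_max_right _ _
  have hM : ∀ a, 0 < M (T (p a)) := by
    intro a
    obtain ⟨y, hy, hya⟩ := mem_iUnion₂.1 (hcov ⟨p a, hpB a, rfl⟩)
    refine Finset.sum_pos' (fun i _ => hm0 i _) ⟨⟨y, hy⟩, Finset.mem_univ _, ?_⟩
    exact lt_max_of_lt_left (sub_pos.2 hya)
  let f : EuclideanSpace ℝ s → EuclideanSpace ℝ s := fun a =>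
    WithLp.toLp 2 fun i => m i (T (p a)) / M (T (p a))
  have hfc : Continuous f := by
    refine (PiLp.continuous_toLp 2 _).comp (continuous_pi fun i => ?_)
    refine Continuous.div ?_ ?_ fun a => (hM a).ne' <;> fun_prop
  have hf0 : ∀ a i, 0 ≤ f a i := fun a i => div_nonneg (hm0 _ _) (hM a).le
  have hfsum : ∀ a, ∑ i, f a i = 1 := by
    intro a
    simp only [f]
    rw [← Finset.sum_div, div_self (hM a).ne']
  have hf1 : ∀ a, ‖f a‖ ≤ 1 := by
    intro a
    rw [EuclideanSpace.norm_eq]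
    refine Real.sqrt_le_one.2 ?_
    rw [← hfsum a]
    refine Finset.sum_le_sum fun i _ => ?_
    have h1 : f a i ≤ 1 := by
      rw [← hfsum a]
      exact Finset.single_le_sum (f := fun i => f a i) (fun j _ => hf0 a j) (Finset.mem_univ i)
    rw [Real.norm_of_nonneg (hf0 a i)]
    nlinarith [hf0 a i]
  obtain ⟨a, ha⟩ := exists_fixedPoint_of_continuous_of_norm_le_one hfc hf1
  refine ⟨p a, hpB a, ?_⟩
  have ha0 : ∀ i, 0 ≤ a i := fun i => by rw [← ha]; exact hf0 a i
  have hasum : ∑ i, a i = 1 := by rw [← hfsum a, ha]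
  have hpa : p a = ∑ i, a i • (i : H) := by
    have h1 : ∀ i, max (a i) 0 = a i := fun i => max_eq_left (ha0 i)
    have h2 : σ a = 1 := by simp only [σ, h1, hasum, max_self]
    simp only [p, h1, h2, div_one, hasum, sub_self, zero_smul, zero_add]
  have hTp : T (p a) - p a = ∑ i, a i • (T (p a) - (i : H)) := by
    simp only [smul_sub, Finset.sum_sub_distrib]
    rw [← Finset.sum_smul, hasum, one_smul, ← hpa]
  rw [dist_eq_norm, hTp]
  calc ‖∑ i, a i • (T (p a) - (i : H))‖ ≤ ∑ i, a i * ε := by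
        refine norm_sum_le_of_le _ fun i _ => ?_
        rw [norm_smul, Real.norm_of_nonneg (ha0 i)]
        by_cases hi : a i = 0
        · simp [hi]
        · refine mul_le_mul_of_nonneg_left ?_ (ha0 i)
          by_contra! hlt
          apply hi
          rw [← ha]
          have : m i (T (p a)) = 0 := max_eq_right (by rw [dist_eq_norm]; linarith)
          simp [f, this]
    _ = ε := by rw [← Finset.sum_mul, hasum, one_mul]

/-- **Schauder's fixed point theorem**. -/
theorem exists_fixedPoint_of_isCompact_closure_image {T : H → H} {B : Set H} (hT : Continuous T)
    (hB : Convex ℝ B) (hBne : B.Nonempty) (hTB : MapsTo T B B)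
    (hc : IsCompact (closure (T '' B))) : ∃ u, T u = u := by
  choose x hxB hx using fun n : ℕ => exists_dist_le_of_isCompact_closure_image hT hB hBne hTB hc
    (Nat.one_div_pos_of_nat (α := ℝ) (n := n))
  -- `B` is not assumed closed, so the limit `u` is not claimed to lie in it.
  obtain ⟨u, -, φ, hφ, hu⟩ := hc.tendsto_subseq (x := fun n => T (x n))
    fun n => subset_closure ⟨x n, hxB n, rfl⟩
  have hd : Tendsto (fun n => dist (T (x (φ n))) (x (φ n))) atTop (𝓝 0) :=
    squeeze_zero (fun _ => dist_nonneg) (fun n => hx (φ n))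
      (tendsto_one_div_add_atTop_nhds_zero_nat.comp hφ.tendsto_atTop)
  have hxu : Tendsto (fun n => x (φ n)) atTop (𝓝 u) := (tendsto_iff_of_dist hd).1 hu
  exact ⟨u, tendsto_nhds_unique ((hT.tendsto u).comp hxu) hu⟩

end Schauder

/-! ### `L²` norms tested against smooth functions -/

section L2Duality

theorem real_inner_eq_mul (x y : ℝ) : inner ℝ x y = x * y := by
  rw [real_inner_comm]
  rfl

variable {α : Type*} [MeasurableSpace α] {μ : Measure α}

theorem abs_integral_mul_le {f g : α → ℝ} (hf : MemLp f 2 μ) (hg : MemLp g 2 μ) :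
    |∫ x, f x * g x ∂μ| ≤ (eLpNorm f 2 μ).toReal * (eLpNorm g 2 μ).toReal := by
  have h := abs_real_inner_le_norm (hf.toLp f) (hg.toLp g)
  rw [L2.inner_def, Lp.norm_toLp, Lp.norm_toLp] at h
  convert h using 2
  refine integral_congr_ae ?_
  filter_upwards [hf.coeFn_toLp, hg.coeFn_toLp] with x hx hy
  rw [hx, hy, real_inner_eq_mul]

/-- Test functions are dense in `L²(U)`, because a function orthogonal to all of them vanishes
almost everywhere. The bound therefore extends to every `g` in `L²(U)`, and `g = f` gives the claim.
-/
theorem eLpNorm_two_le_of_abs_integral_mul_contDiff_le {U : Set Plane} (hU : IsOpen U)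
    {f : Plane → ℝ} (hf : MemLp f 2 (volume.restrict U)) {M : ℝ} (hM : 0 ≤ M)
    (h : ∀ ψ : Plane → ℝ, ContDiff ℝ ∞ ψ → HasCompactSupport ψ → tsupport ψ ⊆ U →
      |∫ x in U, f x * ψ x| ≤ M * (eLpNorm ψ 2 (volume.restrict U)).toReal) :
    eLpNorm f 2 (volume.restrict U) ≤ ENNReal.ofReal M := by
  let S : Submodule ℝ (Lp ℝ 2 (volume.restrict U)) :=
    { carrier := {g | ∃ ψ : Plane → ℝ, ContDiff ℝ ∞ ψ ∧ HasCompactSupport ψ ∧ tsupport ψ ⊆ U ∧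
        g =ᵐ[volume.restrict U] ψ}
      zero_mem' := ⟨fun _ => 0, contDiff_const, HasCompactSupport.zero,
        by simp [tsupport], Lp.coeFn_zero _ _ _⟩
      add_mem' := by
        rintro a b ⟨ψ, h1, h2, h3, h4⟩ ⟨ψ', h1', h2', h3', h4'⟩
        exact ⟨ψ + ψ', h1.add h1', h2.add h2', (tsupport_add ψ ψ').trans (union_subset h3 h3'),
          (Lp.coeFn_add a b).trans (h4.add h4')⟩
      smul_mem' := by
        rintro c a ⟨ψ, h1, h2, h3, h4⟩
        exact ⟨c • ψ, h1.const_smul c, h2.mono (Function.support_const_smul_subset c ψ),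
          (closure_mono (Function.support_const_smul_subset c ψ)).trans h3,
          (Lp.coeFn_smul c a).trans (h4.const_smul c)⟩ }
  have hS : S.topologicalClosure = ⊤ := by
    rw [Submodule.topologicalClosure_eq_top_iff, Submodule.eq_bot_iff]
    intro g hg
    have hloc : LocallyIntegrableOn g U volume := by
      exact locallyIntegrableOn_of_locallyIntegrable_restrict
        ((Lp.memLp g).locallyIntegrable (by norm_num))
    have h0 := hU.ae_eq_zero_of_integral_contDiff_smul_eq_zero hloc fun ψ h1 h2 h3 => by
      have hψ : MemLp ψ 2 (volume.restrict U) := h1.continuous.memLp_of_hasCompactSupport h2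
      have := (Submodule.mem_orthogonal S g).1 hg (hψ.toLp ψ) ⟨ψ, h1, h2, h3, hψ.coeFn_toLp⟩
      rw [L2.inner_def] at this
      rw [← setIntegral_eq_integral_of_forall_compl_eq_zero (s := U), ← this]
      · refine integral_congr_ae ?_
        filter_upwards [hψ.coeFn_toLp] with x hx
        rw [hx, real_inner_eq_mul, smul_eq_mul]
      · intro x hx
        rw [image_eq_zero_of_notMem_tsupport fun hx' => hx (h3 hx'), zero_smul]
    rw [Lp.eq_zero_iff_ae_eq_zero]
    exact (ae_restrict_iff' hU.measurableSet).2 h0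
  have hle : ∀ g : Lp ℝ 2 (volume.restrict U), |inner ℝ (hf.toLp f) g| ≤ M * ‖g‖ := by
    intro g
    have hg : g ∈ closure (S : Set (Lp ℝ 2 (volume.restrict U))) := by
      rw [← Submodule.topologicalClosure_coe, hS]
      trivial
    have hcl : IsClosed {g : Lp ℝ 2 (volume.restrict U) | |inner ℝ (hf.toLp f) g| ≤ M * ‖g‖} :=
      isClosed_le (by fun_prop) (by fun_prop)
    refine closure_minimal ?_ hcl hg
    rintro a ⟨ψ, h1, h2, h3, h4⟩
    have h5 := h ψ h1 h2 h3
    rw [mem_ofPred_eq, L2.inner_def, Lp.norm_def, eLpNorm_congr_ae h4]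
    convert h5 using 2
    refine integral_congr_ae ?_
    filter_upwards [hf.coeFn_toLp, h4] with x hx hy
    rw [hx, hy, real_inner_eq_mul]
  have h1 := hle (hf.toLp f)
  rw [real_inner_self_eq_norm_sq, abs_of_nonneg (by positivity), sq] at h1
  have h2 : ‖hf.toLp f‖ ≤ M := by
    by_contra! hlt
    nlinarith [norm_nonneg (hf.toLp f)]
  rw [Lp.norm_toLp] at h2
  exact (ENNReal.le_ofReal_iff_toReal_le hf.eLpNorm_ne_top hM).2 h2

end L2Duality

/-! ### Translation estimate for Sobolev functions -/

section Sobolev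

variable {Ω : Set Plane}

/-- The extension by zero of an element of `W^{1,2}(Ω)`. -/
noncomputable def W12.ext (v : W12 Ω) : Plane → ℝ := Ω.indicator v.val

theorem W12.memLp_ext (hΩ : IsOpen Ω) (v : W12 Ω) : MemLp v.ext 2 volume :=
  (memLp_indicator_iff_restrict hΩ.measurableSet).2 (Lp.memLp v.val)

theorem hasDerivAt_integral_mul_translate {u : Plane → ℝ} (hu : Integrable u (volume.restrict Ω)) {ψ : Plane → ℝ} (hψ : ContDiff ℝ ∞ ψ)
    (hc : HasCompactSupport ψ) (h : Plane) (s : ℝ) :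
    HasDerivAt (fun s : ℝ => ∫ y in Ω, u y * ψ (y - s • h))
      (-∫ y in Ω, u y * fderiv ℝ ψ (y - s • h) h) s := by
  have hcd : Continuous (fderiv ℝ ψ) := hψ.continuous_fderiv (by simp)
  obtain ⟨C, hC⟩ := (hcd.bounded_above_of_compact_support (hc.fderiv ℝ))
  have hdiff : Differentiable ℝ ψ := hψ.differentiable (by simp)
  obtain ⟨C', hC'⟩ := hψ.continuous.bounded_above_of_compact_support hc
  have hm : ∀ r : ℝ, AEStronglyMeasurable (fun y => u y * ψ (y - r • h)) (volume.restrict Ω) :=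
    fun r => hu.1.mul (hψ.continuous.comp (by fun_prop)).aestronglyMeasurable
  have := (hasDerivAt_integral_of_dominated_loc_of_deriv_le (μ := volume.restrict Ω)
    (F := fun (r : ℝ) y => u y * ψ (y - r • h)) (F' := fun (r : ℝ) y => -(u y * fderiv ℝ ψ (y - r • h) h))
    (x₀ := s) (s := univ) (bound := fun y => ‖u y‖ * (C * ‖h‖)) Filter.univ_mem
    (Filter.Eventually.of_forall hm) ?_ ?_ ?_ (hu.norm.mul_const _) ?_).2
  · rwa [integral_neg] at this
  · refine (hu.norm.mul_const C').mono' (hm s) (Filter.Eventually.of_forall fun y => ?_)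
    rw [norm_mul]
    exact mul_le_mul_of_nonneg_left (hC' _) (norm_nonneg _)
  · have : Continuous fun y => fderiv ℝ ψ (y - s • h) h :=
      (hcd.comp (by fun_prop)).clm_apply continuous_const
    exact (hu.1.mul this.aestronglyMeasurable).neg
  · refine Filter.Eventually.of_forall fun y r _ => ?_
    rw [norm_neg, norm_mul]
    refine mul_le_mul_of_nonneg_left ?_ (norm_nonneg _)
    exact ((fderiv ℝ ψ (y - r • h)).le_opNorm h).trans
      (mul_le_mul_of_nonneg_right (hC _) (norm_nonneg _))
  · refine Filter.Eventually.of_forall fun y r _ => ?_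
    have h1 : HasDerivAt (fun r : ℝ => y - r • h) (-h) r := by
      simpa using ((hasDerivAt_id r).smul_const h).const_sub y
    have h2 := ((hdiff (y - r • h)).hasFDerivAt.comp_hasDerivAt r h1).const_mul (u y)
    simpa using h2

theorem W12.integral_mul_fderiv_apply (v : W12 Ω) {φ : Plane → ℝ} (hφ : ContDiff ℝ ∞ φ)
    (hc : HasCompactSupport φ) (hs : tsupport φ ⊆ Ω) (h : Plane) :
    ∫ y in Ω, v.val y * fderiv ℝ φ y h = -∫ y in Ω, inner ℝ h (v.grad y) * φ y := by
  have hh : h = ∑ i, h i • EuclideanSpace.single i (1 : ℝ) := by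
    ext i
    fin_cases i <;> simp [Fin.sum_univ_two]
  have h1 : ∀ y, v.val y * fderiv ℝ φ y h =
      ∑ i, h i * (v.val y * fderiv ℝ φ y (EuclideanSpace.single i 1)) := by
    intro y
    conv_lhs => rw [hh]
    rw [map_sum, Finset.mul_sum]
    refine Finset.sum_congr rfl fun i _ => ?_
    rw [map_smul, smul_eq_mul]
    ring
  have h2 : ∀ y, inner ℝ h (v.grad y) * φ y = ∑ i, h i * (v.grad y i * φ y) := by
    intro y
    rw [PiLp.inner_apply, Finset.sum_mul]
    refine Finset.sum_congr rfl fun i _ => ?_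
    rw [real_inner_eq_mul]
    ring
  simp_rw [h1, h2]
  rw [integral_finsetSum _ fun i _ => (integrable_mul_partial _ hφ hc i).const_mul _,
    integral_finsetSum _ fun i _ => (integrable_coord_mul _ hφ hc i).const_mul _,
    ← Finset.sum_neg_distrib]
  refine Finset.sum_congr rfl fun i _ => ?_
  rw [integral_const_mul, integral_const_mul, ← mul_neg]
  congr 1
  exact v.2 φ hφ hc hs i

/-- The `L²` modulus of continuity of a Sobolev function under translations which stay inside the
domain. -/
theorem W12.eLpNorm_translate_sub_le (hΩ : IsOpen Ω) (hfin : volume Ω ≠ ⊤) (v : W12 Ω)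
    {U : Set Plane} (hU : IsOpen U) {h : Plane}
    (hUh : ∀ x ∈ U, ∀ s ∈ Icc (0 : ℝ) 1, x + s • h ∈ Ω) :
    eLpNorm (fun x => v.ext (x + h) - v.ext x) 2 (volume.restrict U) ≤
      ENNReal.ofReal ‖h‖ * ‖v.grad‖ₑ := by
  have : IsFiniteMeasure (volume.restrict Ω) := ⟨by simpa using hfin.lt_top⟩
  have hmp : MeasurePreserving (fun x : Plane => x + h) := measurePreserving_add_right volume h
  have hext := v.memLp_ext hΩ
  have hext' : MemLp (fun x => v.ext (x + h)) 2 volume := hext.comp_measurePreserving hmp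
  have hnorm : ENNReal.ofReal ‖h‖ * ‖v.grad‖ₑ = ENNReal.ofReal (‖h‖ * ‖v.grad‖) := by
    rw [ENNReal.ofReal_mul (norm_nonneg _), ofReal_norm, ofReal_norm]
  rw [hnorm]
  refine eLpNorm_two_le_of_abs_integral_mul_contDiff_le hU
    ((hext'.sub hext).restrict U) (by positivity) fun ψ hψ hc hs => ?_
  have hψ2 : MemLp ψ 2 volume := hψ.continuous.memLp_of_hasCompactSupport hc
  have hψU : eLpNorm ψ 2 (volume.restrict U) = eLpNorm ψ 2 volume :=
    eLpNorm_restrict_eq_of_support_subset ((subset_tsupport ψ).trans hs)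
  have htr : ∀ s : ℝ, MemLp (fun y => ψ (y - s • h)) 2 volume := fun s =>
    hψ2.comp_measurePreserving (measurePreserving_sub_right volume _)
  have htrn : ∀ s : ℝ, eLpNorm (fun y => ψ (y - s • h)) 2 volume = eLpNorm ψ 2 volume := fun s =>
    eLpNorm_comp_measurePreserving hψ2.1 (measurePreserving_sub_right volume _)
  -- With the translation moved to the test function, `F 1 - F 0` is the pairing of the difference
  -- quotient's numerator with `ψ`. The weak gradient and Cauchy–Schwarz bound `F'`, and the mean
  -- value inequality concludes.
  let F : ℝ → ℝ := fun s => ∫ y in Ω, v.val y * ψ (y - s • h)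
  have hvi : Integrable v.val (volume.restrict Ω) := (Lp.memLp v.val).integrable (by norm_num)
  have hF : ∀ s, HasDerivAt F (-∫ y in Ω, v.val y * fderiv ℝ ψ (y - s • h) h) s := fun s =>
    hasDerivAt_integral_mul_translate hvi hψ hc h s
  have hbound : ∀ s ∈ Icc (0 : ℝ) 1, ‖-∫ y in Ω, v.val y * fderiv ℝ ψ (y - s • h) h‖ ≤
      ‖h‖ * ‖v.grad‖ * (eLpNorm ψ 2 volume).toReal := by
    intro s hs01
    -- Here the whole segment is needed in `Ω`: every intermediate translate of `ψ` must be an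
    -- admissible test function.
    have hsupp : tsupport (fun y => ψ (y - s • h)) ⊆ Ω := by
      intro y hy
      have hy' : y - s • h ∈ tsupport ψ :=
        tsupport_comp_subset_preimage ψ (f := fun y => y - s • h) (by fun_prop) hy
      simpa using hUh _ (hs hy') s hs01
    have hcs : HasCompactSupport fun y => ψ (y - s • h) :=
      hc.comp_homeomorph (Homeomorph.subRight (s • h))
    have h1 := v.integral_mul_fderiv_apply (φ := fun y => ψ (y - s • h))
      (hψ.comp (contDiff_id.sub contDiff_const)) hcs hsupp h
    simp only [fderiv_comp_sub] at h1
    rw [h1, neg_neg, Real.norm_eq_abs]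
    have hinner : MemLp (fun y => inner ℝ h (v.grad y)) 2 (volume.restrict Ω) :=
      (Lp.memLp v.grad).const_inner h
    refine (abs_integral_mul_le hinner ((htr s).restrict Ω)).trans ?_
    refine mul_le_mul ?_ ?_ ENNReal.toReal_nonneg (by positivity)
    · have := eLpNorm_le_mul_eLpNorm_of_ae_le_mul (μ := volume.restrict Ω) (p := 2)
        (f := fun y => inner ℝ h (v.grad y)) (g := v.grad) (c := ‖h‖)
        (Filter.Eventually.of_forall fun y => norm_inner_le_norm _ _)
      refine (ENNReal.toReal_mono (by finiteness) this).trans ?_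
      rw [ENNReal.toReal_mul, ENNReal.toReal_ofReal (norm_nonneg _), Lp.norm_def]
    · refine ENNReal.toReal_mono hψ2.eLpNorm_ne_top ?_
      rw [← htrn s]
      exact eLpNorm_restrict_le _ _ _ _
  have hmv := norm_image_sub_le_of_norm_deriv_le_segment_01' (f := F)
    (fun s _ => (hF s).hasDerivWithinAt) fun s hs01 => hbound s (Ico_subset_Icc_self hs01)
  rw [hψU]
  convert hmv using 1
  rw [Real.norm_eq_abs]
  congr 1
  have hFs : ∀ s ∈ Icc (0 : ℝ) 1, F s = ∫ x in U, v.ext (x + s • h) * ψ x := by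
    intro s hs01
    have h1 : F s = ∫ y, v.ext y * ψ (y - s • h) := by
      simp only [F, W12.ext]
      rw [← integral_indicator hΩ.measurableSet]
      congr 1 with y
      by_cases hy : y ∈ Ω <;> simp [hy]
    rw [h1, ← integral_add_right_eq_self _ (s • h), setIntegral_eq_integral_of_forall_compl_eq_zero]
    · simp
    · intro x hx
      rw [image_eq_zero_of_notMem_tsupport fun hx' => hx (hs hx'), mul_zero]
  rw [hFs 1 (by simp), hFs 0 (by simp), ← integral_sub]
  · simp [sub_mul]
  · simpa using! (hext'.integrable_mul hψ2).restrict
  · simpa using! (hext.integrable_mul hψ2).restrict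

end Sobolev

/-! ### Completeness of `W^{1,2}(Ω)` and the constant functions -/

section SobolevComplete

variable {Ω : Set Plane}

/-- For each test function the defining identity equates two continuous linear functionals of the
pair, both being `L²` inner products with fixed elements. -/
theorem isClosed_sobolevSubmodule (Ω : Set Plane) :
    IsClosed (sobolevSubmodule Ω : Set (WithLp 2 (Lp ℝ 2 (volume.restrict Ω) ×
      Lp Plane 2 (volume.restrict Ω)))) := by
  have : (sobolevSubmodule Ω : Set (WithLp 2 (Lp ℝ 2 (volume.restrict Ω) ×
      Lp Plane 2 (volume.restrict Ω)))) =
      ⋂ (φ : Plane → ℝ) (_ : ContDiff ℝ ∞ φ) (_ : HasCompactSupport φ) (_ : tsupport φ ⊆ Ω)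
        (i : Fin 2), {p | ∫ x in Ω, p.fst x * fderiv ℝ φ x (EuclideanSpace.single i 1) =
          - ∫ x in Ω, p.snd x i * φ x} := by
    ext p
    simp only [mem_iInter]
    rfl
  rw [this]
  refine isClosed_iInter fun φ => isClosed_iInter fun hφ => isClosed_iInter fun hc =>
    isClosed_iInter fun _ => isClosed_iInter fun i => ?_
  have h1 : MemLp (fun x => fderiv ℝ φ x (EuclideanSpace.single i 1)) 2 (volume.restrict Ω) :=
    (((hφ.continuous_fderiv (by simp)).clm_apply continuous_const)).memLp_of_hasCompactSupport
      (hc.fderiv_apply ℝ _)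
  have h2 : MemLp (fun x => φ x • EuclideanSpace.single i (1 : ℝ)) 2 (volume.restrict Ω) :=
    (hφ.continuous.smul continuous_const).memLp_of_hasCompactSupport hc.smul_right
  have e1 : ∀ u : Lp ℝ 2 (volume.restrict Ω),
      ∫ x in Ω, u x * fderiv ℝ φ x (EuclideanSpace.single i 1) = inner ℝ (h1.toLp _) u := by
    intro u
    rw [L2.inner_def]
    refine integral_congr_ae ?_
    filter_upwards [h1.coeFn_toLp] with x hx
    rw [hx, real_inner_eq_mul, mul_comm]
  have e2 : ∀ g : Lp Plane 2 (volume.restrict Ω),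
      ∫ x in Ω, g x i * φ x = inner ℝ (h2.toLp _) g := by
    intro g
    rw [L2.inner_def]
    refine integral_congr_ae ?_
    filter_upwards [h2.coeFn_toLp] with x hx
    rw [hx, real_inner_smul_left, EuclideanSpace.inner_single_left]
    simp [mul_comm]
  simp_rw [e1, e2]
  exact isClosed_eq (continuous_const.inner (WithLp.continuous_fst _ _ _))
    (continuous_const.inner (WithLp.continuous_snd _ _ _)).neg

instance W12.completeSpace : CompleteSpace (W12 Ω) := (isClosed_sobolevSubmodule Ω).completeSpace_coe

theorem W12.norm_sq_eq (v : W12 Ω) : ‖v‖ ^ 2 = ‖v.val‖ ^ 2 + ‖v.grad‖ ^ 2 :=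
  WithLp.prod_norm_sq_eq_of_L2 v.1

theorem W12.norm_val_le (v : W12 Ω) : ‖v.val‖ ≤ ‖v‖ := by
  refine le_of_sq_le_sq ?_ (norm_nonneg _)
  rw [v.norm_sq_eq]
  exact le_add_of_nonneg_right (sq_nonneg _)

theorem W12.val_add (u v : W12 Ω) : (u + v).val = u.val + v.val := rfl
theorem W12.val_sub (u v : W12 Ω) : (u - v).val = u.val - v.val := rfl
theorem W12.val_smul (c : ℝ) (v : W12 Ω) : (c • v).val = c • v.val := rfl
theorem W12.grad_add (u v : W12 Ω) : (u + v).grad = u.grad + v.grad := rfl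
theorem W12.grad_sub (u v : W12 Ω) : (u - v).grad = u.grad - v.grad := rfl
theorem W12.grad_smul (c : ℝ) (v : W12 Ω) : (c • v).grad = c • v.grad := rfl

theorem exists_W12_eq_one (hfin : volume Ω ≠ ⊤) :
    ∃ e : W12 Ω, e.val =ᵐ[volume.restrict Ω] (fun _ => 1) ∧ e.grad = 0 := by
  have : IsFiniteMeasure (volume.restrict Ω) := ⟨by simpa using hfin.lt_top⟩
  have h1 : MemLp (fun _ : Plane => (1 : ℝ)) 2 (volume.restrict Ω) := memLp_const 1
  refine ⟨⟨WithLp.toLp 2 (h1.toLp _, 0), ?_⟩, h1.coeFn_toLp, rfl⟩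
  intro φ hφ hc hs i
  have e1 : ∫ x in Ω, h1.toLp _ x * fderiv ℝ φ x (EuclideanSpace.single i 1) = 0 := by
    have hd : Continuous fun x => fderiv ℝ φ x (EuclideanSpace.single i 1) :=
      (hφ.continuous_fderiv (by simp)).clm_apply continuous_const
    have hd' : Integrable fun x => fderiv ℝ φ x (EuclideanSpace.single i 1) :=
      hd.integrable_of_hasCompactSupport (hc.fderiv_apply ℝ _)
    have h2 := integral_mul_fderiv_eq_neg_fderiv_mul_of_integrable (μ := volume) (𝕜 := ℝ)
      (f := fun _ : Plane => (1 : ℝ)) (g := φ) (v := EuclideanSpace.single i 1)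
      (by simp) (by simpa using hd')
      (by simpa using hφ.continuous.integrable_of_hasCompactSupport hc)
      (fun x _ => differentiableAt_const _) (fun x _ => hφ.differentiable (by simp) x)
    simp only [one_mul, fderiv_fun_const, Pi.zero_apply, zero_apply, zero_mul,
      integral_zero, neg_zero] at h2
    rw [← h2, ← setIntegral_eq_integral_of_forall_compl_eq_zero (s := Ω) (μ := volume)
      (f := fun x => fderiv ℝ φ x (EuclideanSpace.single i 1)) fun x hx =>
        image_eq_zero_of_notMem_tsupport (f := fun x => fderiv ℝ φ x (EuclideanSpace.single i 1))
          fun hx' => hx (hs (tsupport_fderiv_apply_subset ℝ (EuclideanSpace.single i 1) hx'))]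
    refine integral_congr_ae ?_
    filter_upwards [h1.coeFn_toLp] with x hx
    rw [hx, one_mul]
  have e2 : ∫ x in Ω, (0 : Lp Plane 2 (volume.restrict Ω)) x i * φ x = 0 := by
    rw [integral_eq_zero_of_ae]
    filter_upwards [Lp.coeFn_zero Plane 2 (volume.restrict Ω)] with x hx
    rw [hx]
    simp
  change ∫ x in Ω, h1.toLp _ x * fderiv ℝ φ x (EuclideanSpace.single i 1) =
    -∫ x in Ω, (0 : Lp Plane 2 (volume.restrict Ω)) x i * φ x
  rw [e1, e2, neg_zero]

end SobolevComplete

/-! ### Spreading `L²` control through a Lipschitz domain -/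

section SobolevControlled

variable {Ω U U' V W : Set Plane}

theorem eLpNorm_two_sq {α F : Type*} [MeasurableSpace α] {μ : Measure α} [NormedAddCommGroup F]
    (f : α → F) : eLpNorm f 2 μ ^ 2 = ∫⁻ x, ‖f x‖ₑ ^ 2 ∂μ := by
  have := eLpNorm_nnreal_pow_eq_lintegral (f := f) (μ := μ) (p := 2) two_ne_zero
  simpa using this

theorem eLpNorm_restrict_union_le {α F : Type*} [MeasurableSpace α] {μ : Measure α}
    [NormedAddCommGroup F] (f : α → F) (s t : Set α) :
    eLpNorm f 2 (μ.restrict (s ∪ t)) ≤ eLpNorm f 2 (μ.restrict s) + eLpNorm f 2 (μ.restrict t) := by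
  have h : eLpNorm f 2 (μ.restrict (s ∪ t)) ^ 2 ≤
      (eLpNorm f 2 (μ.restrict s) + eLpNorm f 2 (μ.restrict t)) ^ 2 := by
    calc eLpNorm f 2 (μ.restrict (s ∪ t)) ^ 2
        ≤ eLpNorm f 2 (μ.restrict s) ^ 2 + eLpNorm f 2 (μ.restrict t) ^ 2 := by
          simp only [eLpNorm_two_sq]
          exact lintegral_union_le _ s t
      _ ≤ _ := by
          rw [add_sq]
          gcongr
          exact le_self_add
  exact (ENNReal.pow_le_pow_left_iff two_ne_zero).1 h

/-- The `L²`-norm on `U` of a function in `W^{1,2}(Ω)` is controlled by its `L²`-norm on `V` and the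
norm of its gradient on `Ω`. -/
def SobolevControlled (Ω U V : Set Plane) : Prop :=
  ∃ C : NNReal, ∀ v : W12 Ω, eLpNorm v.ext 2 (volume.restrict U) ≤
    C * (eLpNorm v.ext 2 (volume.restrict V) + ‖v.grad‖ₑ)

theorem SobolevControlled.of_subset (h : U ⊆ V) : SobolevControlled Ω U V := by
  refine ⟨1, fun v => ?_⟩
  rw [ENNReal.coe_one, one_mul]
  exact (eLpNorm_mono_measure _ (Measure.restrict_mono h le_rfl)).trans le_self_add

theorem SobolevControlled.trans (h : SobolevControlled Ω U V) (h' : SobolevControlled Ω V W) :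
    SobolevControlled Ω U W := by
  obtain ⟨C, hC⟩ := h
  obtain ⟨C', hC'⟩ := h'
  refine ⟨C * (C' + 1), fun v => (hC v).trans ?_⟩
  rw [ENNReal.coe_mul, mul_assoc]
  gcongr
  rw [ENNReal.coe_add, ENNReal.coe_one, add_mul, one_mul]
  exact add_le_add (hC' v) le_add_self

theorem SobolevControlled.union (h : SobolevControlled Ω U V) (h' : SobolevControlled Ω U' V) :
    SobolevControlled Ω (U ∪ U') V := by
  obtain ⟨C, hC⟩ := h
  obtain ⟨C', hC'⟩ := h'
  refine ⟨C + C', fun v => (eLpNorm_restrict_union_le _ _ _).trans ?_⟩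
  rw [ENNReal.coe_add, add_mul]
  exact add_le_add (hC v) (hC' v)

/-- `v x` is `v (x + h)` minus a difference which the translation estimate bounds by `‖h‖` times the
gradient norm. -/
theorem SobolevControlled.translate (hΩ : IsOpen Ω) (hfin : volume Ω ≠ ⊤) (hU : IsOpen U)
    (hV : IsOpen V) {h : Plane} (hUh : ∀ x ∈ U, ∀ s ∈ Icc (0 : ℝ) 1, x + s • h ∈ Ω)
    (hUV : ∀ x ∈ U, x + h ∈ V) : SobolevControlled Ω U V := by
  refine ⟨1 + ‖h‖₊, fun v => ?_⟩
  have hmp : MeasurePreserving (fun x : Plane => x + h) := measurePreserving_add_right volume h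
  have hext := (v.memLp_ext hΩ).1
  have hext' : AEStronglyMeasurable (fun x => v.ext (x + h)) volume := hext.comp_measurePreserving hmp
  have h1 : eLpNorm (fun x => v.ext (x + h)) 2 (volume.restrict U) ≤
      eLpNorm v.ext 2 (volume.restrict V) := by
    rw [← eLpNorm_comp_measurePreserving (hext.restrict (s := V))
      (hmp.restrict_preimage hV.measurableSet)]
    exact eLpNorm_mono_measure _ (Measure.restrict_mono hUV le_rfl)
  have h2 := v.eLpNorm_translate_sub_le hΩ hfin hU hUh
  have h3 : v.ext = (fun x => v.ext (x + h)) - fun x => v.ext (x + h) - v.ext x := by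
    ext x
    simp
  calc eLpNorm v.ext 2 (volume.restrict U)
      ≤ eLpNorm (fun x => v.ext (x + h)) 2 (volume.restrict U) +
        eLpNorm (fun x => v.ext (x + h) - v.ext x) 2 (volume.restrict U) := by
        conv_lhs => rw [h3]
        exact eLpNorm_sub_le hext'.restrict (hext'.sub hext).restrict (by norm_num)
    _ ≤ eLpNorm v.ext 2 (volume.restrict V) + ‖h‖₊ * ‖v.grad‖ₑ := by
        refine add_le_add h1 (h2.trans_eq ?_)
        rw [ofReal_norm]
        rfl
    _ ≤ _ := by
        rw [ENNReal.coe_add, ENNReal.coe_one, add_mul, one_mul, mul_add]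
        gcongr
        · exact le_self_add
        · exact le_add_self

/-- The centres of controlled balls form an open set that is relatively closed in `Ω` and contains
`x₀`, so connectedness makes it cover `Ω`. -/
theorem SobolevControlled.ball (hΩ : IsOpen Ω) (hfin : volume Ω ≠ ⊤) (hconn : IsPreconnected Ω)
    {x₀ : Plane} {r₀ : ℝ} (hr₀ : 0 < r₀) (hx₀ : x₀ ∈ Ω) {x : Plane} (hx : x ∈ Ω) :
    ∃ r > 0, SobolevControlled Ω (Metric.ball x r) (Metric.ball x₀ r₀) := by
  set G : Set Plane := {x | ∃ r > 0, SobolevControlled Ω (Metric.ball x r) (Metric.ball x₀ r₀)}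
  have hG : IsOpen G := by
    rw [Metric.isOpen_iff]
    rintro y ⟨r, hr, hy⟩
    refine ⟨r, hr, fun z hz => ⟨r - dist z y, sub_pos.2 hz, ?_⟩⟩
    exact (SobolevControlled.of_subset (Metric.ball_subset_ball' (by simp))).trans hy
  refine hconn.subset_of_closure_inter_subset hG
    ⟨x₀, hx₀, r₀, hr₀, SobolevControlled.of_subset subset_rfl⟩ ?_ hx
  rintro y ⟨hyG, hyΩ⟩
  obtain ⟨ρ, hρ, hyρ⟩ := Metric.isOpen_iff.1 hΩ y hyΩ
  obtain ⟨z, ⟨s, hs, hzs⟩, hyz⟩ := Metric.mem_closure_iff.1 hyG (ρ / 2) (by positivity)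
  -- Radius at most `s` makes the shifted ball fit into the controlled one around `z`; radius at
  -- most `ρ / 2`, with a shift shorter than `ρ / 2`, keeps the segments inside `Ω`.
  refine ⟨min s (ρ / 2), by positivity, SobolevControlled.trans ?_ hzs⟩
  refine SobolevControlled.translate hΩ hfin Metric.isOpen_ball Metric.isOpen_ball (h := z - y)
    (fun w hw t ht => hyρ ?_) fun w hw => ?_
  · have hw' : dist w y < ρ / 2 := lt_of_lt_of_le hw (min_le_right _ _)
    rw [Metric.mem_ball]
    calc dist (w + t • (z - y)) y ≤ dist (w + t • (z - y)) w + dist w y := dist_triangle _ _ _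
      _ < ρ / 2 + ρ / 2 := by
        refine add_lt_add_of_le_of_lt ?_ hw'
        rw [dist_eq_norm, add_sub_cancel_left, norm_smul, Real.norm_of_nonneg ht.1,
          ← dist_eq_norm, dist_comm]
        exact (mul_le_of_le_one_left dist_nonneg ht.2).trans hyz.le
      _ = ρ := by ring
  · have : w + (z - y) - z = w - y := by abel
    rw [Metric.mem_ball, dist_eq_norm, this, ← dist_eq_norm]
    exact lt_of_lt_of_le hw (min_le_left _ _)

/-- Near each point, the closure of `Ω` can be shifted into the interior of `Ω` along a segment. -/
theorem IsBoundedLipschitzDomain.exists_shift (hΩ : IsBoundedLipschitzDomain Ω) {p : Plane}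
    (hp : p ∈ frontier Ω) : ∃ δ > 0, ∃ h : Plane,
      ∀ x ∈ closure Ω ∩ Metric.closedBall p δ,
        x + h ∈ Ω ∧ (x ∈ Ω → ∀ s ∈ Icc (0 : ℝ) 1, x + s • h ∈ Ω) := by
  obtain ⟨A, L, γ, r, hγ, hr, hA⟩ := hΩ.lipschitz_boundary p hp
  have hγc := hγ.continuous
  set e : Plane := A.symm (EuclideanSpace.single 1 1) with he
  have hne : ‖e‖ = 1 := by simp [e]
  have hA0 : ∀ (x : Plane) (s : ℝ), A (x + s • e) 0 = A x 0 := by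
    intro x s
    simp [e]
  have hA1 : ∀ (x : Plane) (s : ℝ), A (x + s • e) 1 = A x 1 + s := by
    intro x s
    simp [e]
  have hle : ∀ x ∈ closure Ω, x ∈ Metric.ball p r → γ (A x 0) ≤ A x 1 := by
    intro x hx hxr
    have hcl : IsClosed {x : Plane | γ (A x 0) ≤ A x 1} :=
      isClosed_le (by fun_prop) (by fun_prop)
    have : x ∈ closure (Ω ∩ Metric.ball p r) := by
      rw [inter_comm]
      exact Metric.isOpen_ball.inter_closure ⟨hxr, hx⟩
    refine closure_minimal ?_ hcl this
    rw [hA]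
    exact fun y hy => hy.2.le
  have hmem : ∀ x ∈ Metric.ball p r, γ (A x 0) < A x 1 → x ∈ Ω := by
    intro x hx h
    exact (hA.ge ⟨hx, h⟩ : x ∈ Ω ∩ Metric.ball p r).1
  have hball : ∀ x ∈ Metric.closedBall p (r / 4), ∀ s ∈ Icc (0 : ℝ) (r / 4),
      x + s • e ∈ Metric.ball p r := by
    intro x hx s hs
    rw [Metric.mem_ball]
    calc dist (x + s • e) p ≤ dist (x + s • e) x + dist x p := dist_triangle _ _ _
      _ ≤ r / 4 + r / 4 := by
        refine add_le_add ?_ hx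
        rw [dist_eq_norm, add_sub_cancel_left, norm_smul, hne, mul_one, Real.norm_of_nonneg hs.1]
        exact hs.2
      _ < r := by linarith
  -- Moving along `e` raises the second coordinate and leaves the first fixed, so a point on or
  -- above the graph ends strictly above it. Since `r / 4 + r / 4 < r`, it stays in the chart.
  refine ⟨r / 4, by positivity, (r / 4) • e, fun x ⟨hx, hxp⟩ => ⟨?_, fun hxΩ s hs => ?_⟩⟩
  · refine hmem _ (hball x hxp _ ⟨by positivity, le_rfl⟩) ?_
    rw [hA0, hA1]
    have := hle x hx (Metric.closedBall_subset_ball (by linarith) hxp)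
    linarith
  · rw [smul_smul]
    have hs4 : s * (r / 4) ∈ Icc (0 : ℝ) (r / 4) :=
      ⟨mul_nonneg hs.1 (by positivity), mul_le_of_le_one_left (by positivity) hs.2⟩
    refine hmem _ (hball x hxp _ hs4) ?_
    rw [hA0, hA1]
    have hxr : x ∈ Metric.ball p r := Metric.closedBall_subset_ball (by linarith) hxp
    have := (hA.le ⟨hxΩ, hxr⟩ : x ∈ {x ∈ Metric.ball p r | γ (A x 0) < A x 1}).2
    linarith [hs4.1]

theorem IsBoundedLipschitzDomain.volume_ne_top (hΩ : IsBoundedLipschitzDomain Ω) :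
    volume Ω ≠ ⊤ := hΩ.isBounded.measure_lt_top.ne

theorem SobolevControlled.of_isCompact (hΩ : IsBoundedLipschitzDomain Ω) {S : Set Plane}
    (hS : IsCompact S) (hSΩ : S ⊆ Ω) {x₀ : Plane} {r₀ : ℝ} (hr₀ : 0 < r₀) (hx₀ : x₀ ∈ Ω) :
    ∃ V, IsOpen V ∧ S ⊆ V ∧ SobolevControlled Ω V (Metric.ball x₀ r₀) := by
  refine hS.induction_on (p := fun S => ∃ V, IsOpen V ∧ S ⊆ V ∧
    SobolevControlled Ω V (Metric.ball x₀ r₀)) ?_ ?_ ?_ ?_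
  · exact ⟨∅, isOpen_empty, subset_rfl, SobolevControlled.of_subset (empty_subset _)⟩
  · rintro s t hst ⟨V, hV, htV, h⟩
    exact ⟨V, hV, hst.trans htV, h⟩
  · rintro s t ⟨V, hV, hsV, h⟩ ⟨V', hV', htV', h'⟩
    exact ⟨V ∪ V', hV.union hV', union_subset_union hsV htV', h.union h'⟩
  · intro x hx
    obtain ⟨r, hr, h⟩ := SobolevControlled.ball hΩ.isOpen hΩ.volume_ne_top
      hΩ.isConnected.isPreconnected hr₀ hx₀ (hSΩ hx)
    exact ⟨Metric.ball x r, mem_nhdsWithin_of_mem_nhds (Metric.ball_mem_nhds x hr),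
      Metric.ball x r, Metric.isOpen_ball, subset_rfl, h⟩

/-- Control is local, and `closure Ω` is compact. Interior points have controlled balls; near a
boundary point `Ω` is shifted into a compact subset of `Ω`, where control is already known. -/
theorem SobolevControlled.domain (hΩ : IsBoundedLipschitzDomain Ω) {x₀ : Plane} {r₀ : ℝ}
    (hr₀ : 0 < r₀) (hx₀ : x₀ ∈ Ω) : SobolevControlled Ω Ω (Metric.ball x₀ r₀) := by
  have hc : IsCompact (closure Ω) := hΩ.isBounded.isCompact_closure
  have := hc.induction_on (p := fun S => SobolevControlled Ω (S ∩ Ω) (Metric.ball x₀ r₀)) ?_ ?_ ?_ ?_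
  · rwa [inter_eq_right.2 subset_closure] at this
  · exact SobolevControlled.of_subset (by simp)
  · exact fun s t hst h =>
      (SobolevControlled.of_subset (inter_subset_inter_left _ hst)).trans h
  · intro s t h h'
    rw [union_inter_distrib_right]
    exact h.union h'
  · intro x hx
    by_cases hxΩ : x ∈ Ω
    · obtain ⟨r, hr, h⟩ := SobolevControlled.ball hΩ.isOpen hΩ.volume_ne_top
        hΩ.isConnected.isPreconnected hr₀ hx₀ hxΩ
      exact ⟨Metric.ball x r, mem_nhdsWithin_of_mem_nhds (Metric.ball_mem_nhds x hr),
        (SobolevControlled.of_subset inter_subset_left).trans h⟩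
    · have hxf : x ∈ frontier Ω := by
        rw [hΩ.isOpen.frontier_eq]
        exact ⟨hx, hxΩ⟩
      obtain ⟨δ, hδ, h, hh⟩ := hΩ.exists_shift hxf
      have hcomp : IsCompact ((fun y => y + h) '' (closure Ω ∩ Metric.closedBall x δ)) :=
        (hc.inter_right Metric.isClosed_closedBall).image (by fun_prop)
      obtain ⟨V, hV, hSV, hVc⟩ := SobolevControlled.of_isCompact hΩ hcomp
        (image_subset_iff.2 fun y hy => (hh y hy).1) hr₀ hx₀
      refine ⟨Metric.ball x δ, mem_nhdsWithin_of_mem_nhds (Metric.ball_mem_nhds x hδ),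
        SobolevControlled.trans ?_ hVc⟩
      have hsub : ∀ y ∈ Metric.ball x δ ∩ Ω, y ∈ closure Ω ∩ Metric.closedBall x δ := fun y hy =>
        ⟨subset_closure hy.2, Metric.ball_subset_closedBall hy.1⟩
      exact SobolevControlled.translate hΩ.isOpen hΩ.volume_ne_top
        (Metric.isOpen_ball.inter hΩ.isOpen) hV
        (fun y hy => (hh y (hsub y hy)).2 hy.2) fun y hy => hSV ⟨y, hsub y hy, rfl⟩

end SobolevControlled

/-! ### The Poincaré–Wirtinger inequality -/

section PoincareWirtinger

variable {Ω : Set Plane}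

/-- The double integral form of the Poincaré inequality on a ball. -/
theorem W12.lintegral_lintegral_sub_le (hΩ : IsOpen Ω) (hfin : volume Ω ≠ ⊤) {x₀ : Plane} {r : ℝ}
    (hB : Metric.ball x₀ r ⊆ Ω) (v : W12 Ω) {f : Plane → ℝ} (hf : Measurable f)
    (hfv : v.ext =ᵐ[volume] f) :
    ∫⁻ y in Metric.ball x₀ r, ∫⁻ x in Metric.ball x₀ r, ‖f x - f y‖ₑ ^ 2 ≤
      volume (Metric.ball (0 : Plane) (2 * r)) * (ENNReal.ofReal (2 * r) * ‖v.grad‖ₑ) ^ 2 := by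
  set B := Metric.ball x₀ r with hBdef
  have hBm : MeasurableSet B := measurableSet_ball
  let k : Plane → Plane → ℝ≥0∞ := fun y x =>
    B.indicator 1 y * B.indicator 1 x * ‖f x - f y‖ₑ ^ 2
  have hi : Measurable (B.indicator (1 : Plane → ℝ≥0∞)) := measurable_one.indicator hBm
  have h1 : ∫⁻ y in B, ∫⁻ x in B, ‖f x - f y‖ₑ ^ 2 = ∫⁻ y, ∫⁻ x, k y x := by
    rw [← lintegral_indicator hBm]
    refine lintegral_congr fun y => ?_
    by_cases hy : y ∈ B
    · rw [indicator_of_mem hy, ← lintegral_indicator hBm]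
      refine lintegral_congr fun x => ?_
      by_cases hx : x ∈ B <;> simp [k, hx, hy]
    · simp [k, hy]
  -- Substituting `x = y + z` and exchanging the integrals leaves, for each `z`, the squared norm of
  -- a translation difference. The measurable representative `f` serves this exchange.
  have h2 : ∀ y, ∫⁻ x, k y x = ∫⁻ z, k y (y + z) := fun y =>
    (lintegral_add_left_eq_self _ y).symm
  have h3 : ∫⁻ y, ∫⁻ x, k y x = ∫⁻ z, ∫⁻ y, k y (y + z) := by
    simp_rw [h2]
    refine lintegral_lintegral_swap (Measurable.aemeasurable ?_)
    simp only [Function.uncurry_def, k]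
    fun_prop
  rw [h1, h3]
  have h4 : ∀ z, ∫⁻ y, k y (y + z) ≤ (Metric.ball (0 : Plane) (2 * r)).indicator
      (fun _ => (ENNReal.ofReal (2 * r) * ‖v.grad‖ₑ) ^ 2) z := by
    intro z
    -- The points `y` with both `y` and `y + z` in the ball. Convexity keeps the segment between
    -- them there, and the set is empty once `‖z‖ ≥ 2 * r`.
    set Uz : Set Plane := B ∩ (fun y => y + z) ⁻¹' B with hUz
    have hUo : IsOpen Uz := Metric.isOpen_ball.inter (Metric.isOpen_ball.preimage (by fun_prop))
    have hk : ∫⁻ y, k y (y + z) = ∫⁻ y in Uz, ‖f (y + z) - f y‖ₑ ^ 2 := by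
      rw [← lintegral_indicator hUo.measurableSet]
      refine lintegral_congr fun y => ?_
      by_cases hy : y ∈ B <;> by_cases hyz : y + z ∈ B <;> simp [k, hy, hyz, hUz]
    rw [hk]
    by_cases hz : z ∈ Metric.ball (0 : Plane) (2 * r)
    · rw [indicator_of_mem hz]
      have h5 := v.eLpNorm_translate_sub_le hΩ hfin hUo (h := z) fun x hx s hs => by
        refine hB ?_
        have hconv : Convex ℝ B := convex_ball x₀ r
        have := hconv.add_smul_sub_mem hx.1 hx.2 hs
        simpa using this
      have h6 : (fun x => v.ext (x + z) - v.ext x) =ᵐ[volume.restrict Uz]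
          fun x => f (x + z) - f x := by
        refine ae_restrict_of_ae ?_
        have hq : Filter.Tendsto (fun x : Plane => x + z) (ae volume) (ae volume) :=
          (measurePreserving_add_right volume z).quasiMeasurePreserving.tendsto_ae
        filter_upwards [hfv, hq.eventually hfv] with x hx hxz
        rw [hx, hxz]
      rw [eLpNorm_congr_ae h6] at h5
      rw [← eLpNorm_two_sq]
      gcongr
      refine h5.trans ?_
      gcongr
      simpa using (Metric.mem_ball.1 hz).le
    · have : Uz = ∅ := by
        refine eq_empty_of_forall_notMem fun y hy => hz ?_
        have h1 : dist y x₀ < r := hy.1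
        have h2 : dist (y + z) x₀ < r := hy.2
        rw [Metric.mem_ball, dist_zero_right]
        calc ‖z‖ = dist (y + z) y := by rw [dist_eq_norm, add_sub_cancel_left]
          _ ≤ dist (y + z) x₀ + dist x₀ y := dist_triangle _ _ _
          _ < 2 * r := by rw [dist_comm x₀ y]; linarith
      rw [this]
      simp
  refine (lintegral_mono h4).trans ?_
  rw [lintegral_indicator measurableSet_ball, setLIntegral_const, mul_comm]

/-- The Poincaré inequality on a ball. -/
theorem exists_eLpNorm_sub_const_ball_le (hΩ : IsOpen Ω) (hfin : volume Ω ≠ ⊤) {x₀ : Plane} {r : ℝ}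
    (hr : 0 < r) (hB : Metric.ball x₀ r ⊆ Ω) :
    ∃ C : NNReal, ∀ v : W12 Ω, ∃ c : ℝ,
      eLpNorm (fun x => v.ext x - c) 2 (volume.restrict (Metric.ball x₀ r)) ≤ C * ‖v.grad‖ₑ := by
  set B := Metric.ball x₀ r with hBdef
  have hB0 : volume B ≠ 0 := (Metric.measure_ball_pos _ _ hr).ne'
  have hBt : volume B ≠ ⊤ := measure_ball_lt_top.ne
  set K : ℝ≥0∞ := volume (Metric.ball (0 : Plane) (2 * r)) / volume B * ENNReal.ofReal (2 * r) ^ 2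
  have hK : K ≠ ⊤ := ENNReal.mul_ne_top (ENNReal.div_ne_top measure_ball_lt_top.ne hB0)
    (by finiteness)
  refine ⟨(K ^ (1 / 2 : ℝ)).toNNReal, fun v => ?_⟩
  rw [ENNReal.coe_toNNReal (by finiteness)]
  have hm := (v.memLp_ext hΩ).1.aemeasurable
  have hle := v.lintegral_lintegral_sub_le hΩ hfin hB hm.measurable_mk hm.ae_eq_mk
  set f := hm.mk
  have hfm : Measurable f := hm.measurable_mk
  have hmeas : Measurable fun y => ∫⁻ x in B, ‖f x - f y‖ₑ ^ 2 := by
    refine Measurable.lintegral_prod_right' (f := fun p : Plane × Plane => ‖f p.2 - f p.1‖ₑ ^ 2) ?_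
    fun_prop
  -- Some `y` has inner integral at most the average; the constant is then the value `f y`, and no
  -- mean value of `v` is needed.
  obtain ⟨y, -, hy⟩ := exists_le_setLAverage hB0 hBt hmeas.aemeasurable
  refine ⟨f y, ?_⟩
  have hae : (fun x => v.ext x - f y) =ᵐ[volume.restrict B] fun x => f x - f y := by
    filter_upwards [ae_restrict_of_ae hm.ae_eq_mk] with x hx
    rw [hx]
  rw [eLpNorm_congr_ae hae]
  have h1 : eLpNorm (fun x => f x - f y) 2 (volume.restrict B) ^ 2 ≤
      (K ^ (1 / 2 : ℝ) * ‖v.grad‖ₑ) ^ 2 := by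
    rw [eLpNorm_two_sq, mul_pow, ← ENNReal.rpow_natCast (K ^ (1 / 2 : ℝ)), ← ENNReal.rpow_mul]
    norm_num
    refine hy.trans ?_
    rw [setLAverage_eq]
    refine (ENNReal.div_le_div_right hle _).trans_eq ?_
    simp only [K, mul_pow, div_eq_mul_inv]
    ring
  exact (ENNReal.pow_le_pow_left_iff two_ne_zero).1 h1

theorem W12.grad_sub_smul {e : W12 Ω} (he' : e.grad = 0) (v : W12 Ω) (c : ℝ) :
    (v - c • e).grad = v.grad := by
  rw [W12.grad_sub, W12.grad_smul, he', smul_zero, sub_zero]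

theorem W12.enorm_val_eq (hΩ : IsOpen Ω) (v : W12 Ω) :
    ‖v.val‖ₑ = eLpNorm v.ext 2 (volume.restrict Ω) := by
  rw [Lp.enorm_def]
  refine eLpNorm_congr_ae ?_
  filter_upwards [ae_restrict_mem hΩ.measurableSet] with x hx
  rw [W12.ext, indicator_of_mem hx]

theorem W12.ext_sub_smul (hΩ : IsOpen Ω) {e : W12 Ω} (he : e.val =ᵐ[volume.restrict Ω] fun _ => 1)
    (v : W12 Ω) (c : ℝ) : (v - c • e).ext =ᵐ[volume.restrict Ω] fun x => v.ext x - c := by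
  filter_upwards [he, Lp.coeFn_sub v.val (c • e.val), Lp.coeFn_smul c e.val,
    ae_restrict_mem hΩ.measurableSet] with x h1 h2 h3 hx
  rw [W12.ext, W12.ext, indicator_of_mem hx, indicator_of_mem hx, W12.val_sub, W12.val_smul, h2,
    Pi.sub_apply, h3, Pi.smul_apply, h1, smul_eq_mul, mul_one]

/-- The Poincaré–Wirtinger inequality on a bounded Lipschitz domain. -/
theorem exists_enorm_sub_const_le (hΩ : IsBoundedLipschitzDomain Ω) {e : W12 Ω}
    (he : e.val =ᵐ[volume.restrict Ω] fun _ => 1) (he' : e.grad = 0) :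
    ∃ C : NNReal, ∀ v : W12 Ω, ∃ c : ℝ, ‖(v - c • e).val‖ₑ ≤ C * ‖v.grad‖ₑ := by
  obtain ⟨x₀, hx₀⟩ := hΩ.isConnected.nonempty
  obtain ⟨r, hr, hB⟩ := Metric.isOpen_iff.1 hΩ.isOpen x₀ hx₀
  obtain ⟨C, hC⟩ := exists_eLpNorm_sub_const_ball_le hΩ.isOpen hΩ.volume_ne_top hr hB
  obtain ⟨C', hC'⟩ := SobolevControlled.domain hΩ hr hx₀
  refine ⟨C' * (C + 1), fun v => ?_⟩
  obtain ⟨c, hc⟩ := hC v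
  refine ⟨c, ?_⟩
  have hext := W12.ext_sub_smul hΩ.isOpen he v c
  have hgrad := W12.grad_sub_smul he' v c
  obtain ⟨w, hw⟩ : ∃ w, w = v - c • e := ⟨_, rfl⟩
  rw [← hw] at hext hgrad ⊢
  have h1 := hC' w
  rw [hgrad, eLpNorm_congr_ae (ae_mono (Measure.restrict_mono hB le_rfl) hext)] at h1
  rw [w.enorm_val_eq hΩ.isOpen]
  refine h1.trans ?_
  rw [ENNReal.coe_mul, mul_assoc, ENNReal.coe_add, ENNReal.coe_one, add_mul, one_mul]
  gcongr

/-- A bound for the distance to the line through `e` is attained, up to a factor, by a continuous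
linear projection onto that line. -/
theorem exists_clm_norm_sub_smul_le {H : Type*} [NormedAddCommGroup H] [InnerProductSpace ℝ H]
    (e : H) : ∃ ℓ : H →L[ℝ] ℝ, ∀ (v : H) (c : ℝ), ‖v - ℓ v • e‖ ≤ 2 * ‖v - c • e‖ := by
  -- The coefficient of the orthogonal projection onto the line of `e`; for `e = 0` the inverse is 0
  -- and `ℓ` vanishes. The factor 2 comes from writing `v - ℓ v • e` as `w - ℓ w • e` with `w = v -
  -- c • e`.
  let ℓ : H →L[ℝ] ℝ := (‖e‖ ^ 2)⁻¹ • innerSL ℝ e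
  have hℓ : ∀ w, ℓ w = (‖e‖ ^ 2)⁻¹ * inner ℝ e w := fun w => rfl
  have hnorm : ∀ w, ‖ℓ w • e‖ ≤ ‖w‖ := by
    intro w
    by_cases hez : ‖e‖ = 0
    · simp [hℓ, hez]
    · have h1 := abs_real_inner_le_norm e w
      have h2 : 0 < ‖e‖ := lt_of_le_of_ne (norm_nonneg _) (Ne.symm hez)
      rw [norm_smul, hℓ, norm_mul, Real.norm_of_nonneg (by positivity : 0 ≤ (‖e‖ ^ 2)⁻¹),
        Real.norm_eq_abs, mul_assoc, inv_mul_le_iff₀ (by positivity)]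
      nlinarith
  have hone : ℓ e • e = e := by
    by_cases hez : e = 0
    · simp [hez]
    · have h2 : ‖e‖ ^ 2 ≠ 0 := by simpa using hez
      rw [hℓ, real_inner_self_eq_norm_sq, inv_mul_cancel₀ h2, one_smul]
  refine ⟨ℓ, fun v c => ?_⟩
  have hsplit : v - ℓ v • e = (v - c • e) - ℓ (v - c • e) • e := by
    rw [map_sub, map_smul, sub_smul, smul_assoc, hone]
    abel
  rw [hsplit]
  linarith [norm_sub_le (v - c • e) (ℓ (v - c • e) • e), hnorm (v - c • e)]

theorem le_add_one_mul_of_sq_eq {n a b C : ℝ} (hC : 0 ≤ C) (ha : 0 ≤ a) (hb : 0 ≤ b)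
    (h : n ^ 2 = b ^ 2 + a ^ 2) (hba : b ≤ C * a) : n ≤ (C + 1) * a := by
  refine le_of_sq_le_sq ?_ (by positivity)
  rw [h]
  nlinarith [mul_nonneg hC (mul_nonneg ha ha)]

/-- `W^{1,2}(Ω)` splits into the constants and a complement on which the gradient controls the
norm. -/
theorem exists_norm_sub_smul_le (hΩ : IsBoundedLipschitzDomain Ω) {e : W12 Ω}
    (he : e.val =ᵐ[volume.restrict Ω] fun _ => 1) (he' : e.grad = 0) :
    ∃ (ℓ : W12 Ω →L[ℝ] ℝ) (C : ℝ), ∀ v : W12 Ω, ‖v - ℓ v • e‖ ≤ C * ‖v.grad‖ := by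
  obtain ⟨C, hC⟩ := exists_enorm_sub_const_le hΩ he he'
  obtain ⟨ℓ, hℓ⟩ := exists_clm_norm_sub_smul_le e
  refine ⟨ℓ, 2 * (C + 1), fun v => ?_⟩
  obtain ⟨c, hc⟩ := hC v
  refine (hℓ v c).trans ?_
  have hwg := W12.grad_sub_smul he' v c
  obtain ⟨w, hw⟩ : ∃ w, w = v - c • e := ⟨_, rfl⟩
  rw [← hw] at hwg hc ⊢
  have hwv : ‖w.val‖ ≤ C * ‖v.grad‖ := by
    rw [← ofReal_norm, ← ofReal_norm, ← ENNReal.ofReal_coe_nnreal,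
      ← ENNReal.ofReal_mul NNReal.zero_le_coe] at hc
    exact (ENNReal.ofReal_le_ofReal_iff (by positivity)).1 hc
  have h1 := w.norm_sq_eq
  rw [hwg] at h1
  have hwn : ‖w‖ ≤ (C + 1) * ‖v.grad‖ :=
    le_add_one_mul_of_sq_eq NNReal.zero_le_coe (norm_nonneg _) (norm_nonneg _) h1 hwv
  linarith

end PoincareWirtinger

/-! ### Minimizing a functional that is uniformly convex modulo a line -/

section AbstractMinimization

open Filter Topology

variable {H F : Type*} [NormedAddCommGroup H] [NormedSpace ℝ H]
  [NormedAddCommGroup F] [NormedSpace ℝ F]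

/-- A uniformly convex (in the direction of `G`) functional on a space that splits into a line and a
complement controlled by `G`. -/
structure IsCoerciveEnergy (E : H → ℝ≥0∞) (G : H →L[ℝ] F) (ℓ : H →L[ℝ] ℝ) (e : H) (κ C : ℝ) :
    Prop where
  pos : 0 < κ
  norm_sub_smul_le : ∀ v, ‖v - ℓ v • e‖ ≤ C * ‖G v‖
  le_of_tendsto : ∀ (u : ℕ → H) (u₀ : H) (m : ℝ≥0∞), Tendsto u atTop (𝓝 u₀) →
    Tendsto (fun n => E (u n)) atTop (𝓝 m) → E u₀ ≤ m
  midpoint_add_le : ∀ u v, E ((2⁻¹ : ℝ) • (u + v)) + ENNReal.ofReal (κ * ‖G (u - v)‖ ^ 2) ≤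
    2⁻¹ * (E u + E v)
  midpoint_lt : ∀ u v, u ≠ v → E u ≠ ⊤ → E v ≠ ⊤ → E ((2⁻¹ : ℝ) • (u + v)) < 2⁻¹ * (E u + E v)
  bounded : ∀ M, M ≠ ⊤ → ∃ B : ℝ, ∀ v, E v ≤ M → |ℓ v| ≤ B
  finite : ∃ v, E v ≠ ⊤

namespace IsCoerciveEnergy

variable {E : H → ℝ≥0∞} {G : H →L[ℝ] F} {ℓ : H →L[ℝ] ℝ} {e : H} {κ C : ℝ}

theorem iInf_ne_top (h : IsCoerciveEnergy E G ℓ e κ C) : ⨅ v, E v ≠ ⊤ := by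
  obtain ⟨v, hv⟩ := h.finite
  exact ne_top_of_le_ne_top hv (iInf_le _ v)

/-- A midpoint has energy at least the infimum, so the convexity gap is at most the excess energy of
the two terms; this makes `G (u n)` Cauchy. Linearity of `ℓ` carries this to the complement of the
line. -/
theorem cauchySeq_of_tendsto (h : IsCoerciveEnergy E G ℓ e κ C) {u : ℕ → H}
    (hu : Tendsto (fun n => E (u n)) atTop (𝓝 (⨅ v, E v))) :
    CauchySeq fun n => u n - ℓ (u n) • e := by
  set m := ⨅ v, E v with hm
  have hmt : m ≠ ⊤ := h.iInf_ne_top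
  rw [Metric.cauchySeq_iff]
  intro ε hε
  obtain ⟨η, hη, hηε⟩ : ∃ η > 0, C * η < ε := by
    refine ⟨ε / (|C| + 1), by positivity, ?_⟩
    rw [mul_div_assoc', div_lt_iff₀ (by positivity)]
    nlinarith [le_abs_self C]
  have hlt : m < m + ENNReal.ofReal (κ * η ^ 2) := by
    refine ENNReal.lt_add_right hmt (ENNReal.ofReal_pos.2 ?_).ne'
    have := h.pos
    positivity
  obtain ⟨N, hN⟩ := eventually_atTop.1 (hu.eventually_lt_const hlt)
  refine ⟨N, fun i hi j hj => ?_⟩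
  have h1 : m + ENNReal.ofReal (κ * ‖G (u i - u j)‖ ^ 2) ≤ m + ENNReal.ofReal (κ * η ^ 2) := by
    calc m + ENNReal.ofReal (κ * ‖G (u i - u j)‖ ^ 2)
        ≤ E ((2⁻¹ : ℝ) • (u i + u j)) + ENNReal.ofReal (κ * ‖G (u i - u j)‖ ^ 2) := by
          gcongr
          exact iInf_le _ _
      _ ≤ 2⁻¹ * (E (u i) + E (u j)) := h.midpoint_add_le _ _
      _ ≤ 2⁻¹ * ((m + ENNReal.ofReal (κ * η ^ 2)) + (m + ENNReal.ofReal (κ * η ^ 2))) := by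
          gcongr
          · exact (hN i hi).le
          · exact (hN j hj).le
      _ = m + ENNReal.ofReal (κ * η ^ 2) := by
          rw [← two_mul, ← mul_assoc, ENNReal.inv_mul_cancel two_ne_zero (by simp), one_mul]
  have h2 := (ENNReal.add_le_add_iff_left hmt).1 h1
  rw [ENNReal.ofReal_le_ofReal_iff (by have := h.pos; positivity)] at h2
  have h3 : ‖G (u i - u j)‖ ≤ η :=
    le_of_sq_le_sq (le_of_mul_le_mul_left h2 h.pos) hη.le
  have h4 : (u i - ℓ (u i) • e) - (u j - ℓ (u j) • e) = (u i - u j) - ℓ (u i - u j) • e := by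
    rw [map_sub, sub_smul]
    abel
  rw [dist_eq_norm, h4]
  refine (h.norm_sub_smul_le _).trans_lt ?_
  by_cases hC : 0 ≤ C
  · exact (mul_le_mul_of_nonneg_left h3 hC).trans_lt hηε
  · exact (mul_nonpos_of_nonpos_of_nonneg (not_le.1 hC).le (norm_nonneg _)).trans_lt hε

/-- Only the component along `e` may fail to converge, and it is a bounded real sequence because the
energies are bounded. -/
theorem exists_subseq_tendsto [CompleteSpace H] (h : IsCoerciveEnergy E G ℓ e κ C) {u : ℕ → H}
    (hu : Tendsto (fun n => E (u n)) atTop (𝓝 (⨅ v, E v))) :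
    ∃ (φ : ℕ → ℕ) (u₀ : H), StrictMono φ ∧ Tendsto (u ∘ φ) atTop (𝓝 u₀) ∧ ∀ v, E u₀ ≤ E v := by
  obtain ⟨b, hb⟩ := cauchySeq_tendsto_of_complete (h.cauchySeq_of_tendsto hu)
  have hlt : ⨅ v, E v < (⨅ v, E v) + 1 := ENNReal.lt_add_right h.iInf_ne_top one_ne_zero
  obtain ⟨B, hB⟩ := h.bounded ((⨅ v, E v) + 1)
    (ENNReal.add_ne_top.2 ⟨h.iInf_ne_top, ENNReal.one_ne_top⟩)
  have hfreq : ∃ᶠ n in atTop, ℓ (u n) ∈ Metric.closedBall (0 : ℝ) B := by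
    refine Eventually.frequently ?_
    filter_upwards [hu.eventually_lt_const hlt] with n hn
    simpa using hB _ hn.le
  obtain ⟨c, -, φ, hφ, hc⟩ := tendsto_subseq_of_frequently_bounded Metric.isBounded_closedBall hfreq
  have hlim : Tendsto (u ∘ φ) atTop (𝓝 (b + c • e)) := by
    have := (hb.comp hφ.tendsto_atTop).add (hc.smul_const e)
    simpa [Function.comp_def] using this
  refine ⟨φ, _, hφ, hlim, fun v => ?_⟩
  exact (h.le_of_tendsto _ _ _ hlim (hu.comp hφ.tendsto_atTop)).trans (iInf_le _ v)

theorem eq_of_forall_le (h : IsCoerciveEnergy E G ℓ e κ C) {u v : H} (hu : ∀ w, E u ≤ E w)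
    (hv : ∀ w, E v ≤ E w) : u = v := by
  by_contra hne
  obtain ⟨w, hw⟩ := h.finite
  have huv : E u = E v := le_antisymm (hu v) (hv u)
  have h1 := h.midpoint_lt u v hne (ne_top_of_le_ne_top hw (hu w)) (ne_top_of_le_ne_top hw (hv w))
  rw [← huv, ← two_mul, ← mul_assoc, ENNReal.inv_mul_cancel two_ne_zero (by simp), one_mul] at h1
  exact (hu _).not_gt h1

theorem exists_minimizer [CompleteSpace H] (h : IsCoerciveEnergy E G ℓ e κ C) : ∃ u, ∀ v, E u ≤ E v := by
  obtain ⟨s, -, hs, hmem⟩ := exists_seq_tendsto_sInf (range_nonempty E) (OrderBot.bddBelow _)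
  choose u hu using hmem
  obtain ⟨-, u₀, -, -, hu₀⟩ := h.exists_subseq_tendsto (u := u) (by simp_rw [hu]; exact hs)
  exact ⟨u₀, hu₀⟩

/-- Almost minimizers are close to the minimizer. -/
theorem exists_forall_dist_lt [CompleteSpace H] (h : IsCoerciveEnergy E G ℓ e κ C) {u₀ : H} (hu₀ : ∀ v, E u₀ ≤ E v)
    {ε : ℝ} (hε : 0 < ε) : ∃ m, E u₀ < m ∧ ∀ u, E u ≤ m → dist u u₀ < ε := by
  have hm : E u₀ = ⨅ v, E v := le_antisymm (le_iInf hu₀) (iInf_le _ _)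
  by_contra! hcon
  have hlt : ∀ n : ℕ, E u₀ < E u₀ + (n + 1 : ℝ≥0∞)⁻¹ := fun n =>
    ENNReal.lt_add_right (by rw [hm]; exact h.iInf_ne_top)
      (ENNReal.inv_ne_zero.2 (by finiteness))
  choose u hu hud using fun n : ℕ => hcon _ (hlt n)
  have hinv : Tendsto (fun n : ℕ => (n + 1 : ℝ≥0∞)⁻¹) atTop (𝓝 0) := by
    have := (ENNReal.tendsto_inv_nat_nhds_zero).comp (tendsto_add_atTop_nat 1)
    simpa [Function.comp_def] using this
  have htend : Tendsto (fun n => E (u n)) atTop (𝓝 (⨅ v, E v)) := by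
    rw [← hm]
    refine tendsto_of_tendsto_of_tendsto_of_le_of_le tendsto_const_nhds ?_ (fun n => hu₀ _) hu
    simpa using tendsto_const_nhds.add hinv
  obtain ⟨φ, u₁, -, hlim, hu₁⟩ := h.exists_subseq_tendsto htend
  rw [h.eq_of_forall_le hu₁ hu₀] at hlim
  obtain ⟨n, hn⟩ := (Metric.tendsto_nhds.1 hlim ε hε).exists
  exact absurd hn (hud _).not_gt

end IsCoerciveEnergy

end AbstractMinimization

/-! ### Ellipticity and comparison of tensor fields -/

section TensorForm

variable {Ω : Set Plane}

/-- The quadratic form of a tensor field. -/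
noncomputable def TensorField.form (A : TensorField Ω) (x ξ : Plane) : ℝ :=
  dotProduct ((A.eval x).mulVec ξ.ofLp) ξ.ofLp

theorem TensorField.form_eq (A : TensorField Ω) (x ξ : Plane) :
    A.form x ξ = A.eval x 0 0 * ξ 0 ^ 2 + (A.eval x 0 1 + A.eval x 1 0) * (ξ 0 * ξ 1) +
      A.eval x 1 1 * ξ 1 ^ 2 := by
  simp only [TensorField.form, dotProduct, Matrix.mulVec, Fin.sum_univ_two]
  ring

theorem TensorField.form_smul (A : TensorField Ω) (x ξ : Plane) (c : ℝ) :
    A.form x (c • ξ) = c ^ 2 * A.form x ξ := by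
  simp only [TensorField.form_eq, PiLp.smul_apply, smul_eq_mul]
  ring

theorem TensorField.form_parallelogram (A : TensorField Ω) (x ξ η : Plane) :
    A.form x ((2⁻¹ : ℝ) • (ξ + η)) + A.form x ((2⁻¹ : ℝ) • (ξ - η)) =
      2⁻¹ * (A.form x ξ + A.form x η) := by
  simp only [TensorField.form_eq, PiLp.smul_apply, PiLp.add_apply, PiLp.sub_apply, smul_eq_mul]
  ring

theorem TensorField.eval_of_mem (A : TensorField Ω) {x : Plane} (hx : x ∈ closure Ω) :
    A.eval x = (A ⟨x, hx⟩).1 := by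
  rw [TensorField.eval, dif_pos hx]

theorem TensorField.form_pos (A : TensorField Ω) {x ξ : Plane} (hx : x ∈ closure Ω) (hξ : ξ ≠ 0) :
    0 < A.form x ξ := by
  have h := (A ⟨x, hx⟩).2.dotProduct_mulVec_pos (x := ξ.ofLp)
    (by simpa using hξ)
  rw [TensorField.form, A.eval_of_mem hx, dotProduct_comm]
  simpa using h

theorem TensorField.form_nonneg (A : TensorField Ω) {x : Plane} (hx : x ∈ closure Ω) (ξ : Plane) :
    0 ≤ A.form x ξ := by
  by_cases hξ : ξ = 0
  · simp [hξ, TensorField.form_eq]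
  · exact (A.form_pos hx hξ).le

theorem TensorField.continuous_elem (A : TensorField Ω) (i j : Fin 2) :
    Continuous fun x : closure Ω => A.eval x i j := by
  have h : ∀ x : closure Ω, A.eval x = (A x).1 := fun x => A.eval_of_mem x.2
  simp only [h]
  exact (continuous_subtype_val.comp A.continuous).matrix_elem i j

theorem TensorField.continuous_form_right (A : TensorField Ω) :
    Continuous fun p : closure Ω × Plane => A.form p.1 p.2 := by
  simp only [TensorField.form_eq]
  have h := fun i j => (A.continuous_elem i j).comp (continuous_fst (X := closure Ω) (Y := Plane))
  have h00 := h 0 0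
  have h01 := h 0 1
  have h10 := h 1 0
  have h11 := h 1 1
  simp only [Function.comp_def] at h00 h01 h10 h11
  have h0 : Continuous fun p : closure Ω × Plane => p.2 0 := by fun_prop
  have h1 : Continuous fun p : closure Ω × Plane => p.2 1 := by fun_prop
  exact ((h00.mul (h0.pow 2)).add ((h01.add h10).mul (h0.mul h1))).add (h11.mul (h1.pow 2))

theorem TensorField.continuous_form [LocallyCompactSpace (closure Ω)] :
    Continuous fun p : TensorField Ω × closure Ω × Plane => p.1.form p.2.1 p.2.2 := by
  have h : ∀ p : TensorField Ω × closure Ω × Plane, p.1.eval p.2.1 = (p.1 p.2.1).1 := fun p =>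
    p.1.eval_of_mem p.2.1.2
  have hev : Continuous fun p : TensorField Ω × closure Ω => p.1 p.2 := continuous_eval
  have hpr : Continuous fun p : TensorField Ω × closure Ω × Plane => (p.1, p.2.1) :=
    continuous_fst.prodMk (continuous_fst.comp continuous_snd)
  have he : ∀ i j, Continuous fun p : TensorField Ω × closure Ω × Plane => (p.1 p.2.1).1 i j :=
    fun i j => (continuous_subtype_val.comp (hev.comp hpr)).matrix_elem i j
  simp only [TensorField.form_eq, h]
  have h0 : Continuous fun p : TensorField Ω × closure Ω × Plane => p.2.2 0 :=
    (EuclideanSpace.proj (0 : Fin 2) : Plane →L[ℝ] ℝ).continuous.comp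
      (continuous_snd.comp continuous_snd)
  have h1 : Continuous fun p : TensorField Ω × closure Ω × Plane => p.2.2 1 :=
    (EuclideanSpace.proj (1 : Fin 2) : Plane →L[ℝ] ℝ).continuous.comp
      (continuous_snd.comp continuous_snd)
  exact (((he 0 0).mul (h0.pow 2)).add (((he 0 1).add (he 1 0)).mul (h0.mul h1))).add
    ((he 1 1).mul (h1.pow 2))

/-- The form is continuous and positive on the compact product of `closure Ω` with the unit sphere;
homogeneity covers the other vectors. -/
theorem TensorField.exists_pos_mul_norm_sq_le (hΩ : Bornology.IsBounded Ω) (A : TensorField Ω) :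
    ∃ κ > 0, ∀ x ∈ closure Ω, ∀ ξ : Plane, κ * ‖ξ‖ ^ 2 ≤ A.form x ξ := by
  have : CompactSpace (closure Ω) := isCompact_iff_compactSpace.1 hΩ.isCompact_closure
  have hK : IsCompact ((univ : Set (closure Ω)) ×ˢ Metric.sphere (0 : Plane) 1) :=
    isCompact_univ.prod (isCompact_sphere 0 1)
  obtain ⟨κ, hκ, h⟩ := hK.exists_forall_le' A.continuous_form_right.continuousOn (a := 0)
    fun p hp => A.form_pos p.1.2 (by rintro h0; simpa [h0] using hp.2)
  refine ⟨κ, hκ, fun x hx ξ => ?_⟩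
  by_cases hξ : ξ = 0
  · simpa [hξ] using A.form_nonneg hx 0
  · have h1 := h (⟨x, hx⟩, ‖ξ‖⁻¹ • ξ) ⟨mem_univ _, by simp [norm_smul, hξ]⟩
    simp only [A.form_smul] at h1
    have h2 : 0 < ‖ξ‖ := norm_pos_iff.2 hξ
    rwa [inv_pow, ← div_eq_inv_mul, le_div_iff₀ (by positivity)] at h1

/-- At `b = a` both strict inequalities hold because `1 < c` and `q a` is positive on `K`. They are
open conditions by joint continuity, and compactness makes the neighbourhood of `a` uniform. -/
theorem IsCompact.eventually_lt_mul {T X : Type*} [TopologicalSpace T] [TopologicalSpace X]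
    {K : Set X} (hK : IsCompact K) {q : T → X → ℝ} (hq : Continuous fun p : T × X => q p.1 p.2)
    {a : T} (hpos : ∀ x ∈ K, 0 < q a x) {c : ℝ} (hc : 1 < c) :
    ∀ᶠ b in nhds a, ∀ x ∈ K, q a x < c * q b x ∧ q b x < c * q a x := by
  refine hK.eventually_forall_of_forall_eventually
    (P := fun b x => q a x < c * q b x ∧ q b x < c * q a x) fun x hx => ?_
  have hqa : Continuous fun p : T × X => q a p.2 :=
    hq.comp (continuous_const.prodMk continuous_snd : Continuous fun p : T × X => (a, p.2))
  have hlt : q a x < c * q a x := lt_mul_of_one_lt_left (hpos x hx) hc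
  exact (hqa.continuousAt.eventually_lt (continuous_const.mul hq).continuousAt hlt).and
    (hq.continuousAt.eventually_lt (continuous_const.mul hqa).continuousAt hlt)

/-- Nearby tensor fields have comparable quadratic forms. -/
theorem TensorField.eventually_form_le (hΩ : Bornology.IsBounded Ω) (A : TensorField Ω) {c : ℝ}
    (hc : 1 < c) : ∀ᶠ A' in nhds A, ∀ x ∈ closure Ω, ∀ ξ : Plane,
      A.form x ξ ≤ c * A'.form x ξ ∧ A'.form x ξ ≤ c * A.form x ξ := by
  have : CompactSpace (closure Ω) := isCompact_iff_compactSpace.1 hΩ.isCompact_closure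
  have hK : IsCompact ((univ : Set (closure Ω)) ×ˢ Metric.sphere (0 : Plane) 1) :=
    isCompact_univ.prod (isCompact_sphere 0 1)
  have hev := hK.eventually_lt_mul (q := fun (A : TensorField Ω) p => A.form p.1 p.2)
    TensorField.continuous_form (a := A)
    (fun p hp => A.form_pos p.1.2 (by rintro h0; simpa [h0] using hp.2)) hc
  filter_upwards [hev] with A' hA' x hx ξ
  by_cases hξ : ξ = 0
  · simp [hξ, TensorField.form_eq]
  · have h1 := hA' (⟨x, hx⟩, ‖ξ‖⁻¹ • ξ) ⟨mem_univ _, by simp [norm_smul, hξ]⟩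
    have h2 : 0 < ‖ξ‖⁻¹ ^ 2 := by
      have := norm_pos_iff.2 hξ
      positivity
    simp only [form_smul, mul_left_comm c, mul_lt_mul_iff_right₀ h2] at h1
    exact ⟨h1.1.le, h1.2.le⟩

theorem TensorField.aemeasurable_form (A : TensorField Ω) {g : Plane → Plane}
    (hΩ : MeasurableSet Ω) (hg : AEStronglyMeasurable g (volume.restrict Ω)) :
    AEMeasurable (fun x => A.form x (g x)) (volume.restrict Ω) := by
  have he : ∀ i j, AEMeasurable (fun x => A.eval x i j) (volume.restrict Ω) := by
    intro i j
    refine ContinuousOn.aemeasurable (ContinuousOn.mono ?_ subset_closure) hΩ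
    rw [continuousOn_iff_continuous_domRestrict]
    exact A.continuous_elem i j
  have hgi : ∀ i, AEMeasurable (fun x => g x i) (volume.restrict Ω) := fun i =>
    ((EuclideanSpace.proj i : Plane →L[ℝ] ℝ).continuous.comp_aestronglyMeasurable hg).aemeasurable
  simp only [TensorField.form_eq]
  exact (((he 0 0).mul ((hgi 0).pow_const 2)).add
    (((he 0 1).add (he 1 0)).mul ((hgi 0).mul (hgi 1)))).add ((he 1 1).mul ((hgi 1).pow_const 2))

end TensorForm

/-! ### Convexity of the Dirichlet and fidelity terms -/

section Energy

open Filter Topology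

/-- Fatou's lemma for integrals of Carathéodory integrands along `Lᵖ`-convergent sequences. -/
theorem lintegral_le_of_tendsto_Lp {α F : Type*} [MeasurableSpace α] [NormedAddCommGroup F]
    {μ ν : Measure α} {p : ℝ≥0∞} [Fact (1 ≤ p)] (hνμ : ν ≪ μ) {Φ : α → F → ℝ≥0∞}
    (hΦ : ∀ x, Continuous (Φ x)) {g : ℕ → Lp F p μ} {g₀ : Lp F p μ}
    (hm : ∀ n, AEMeasurable (fun x => Φ x (g n x)) ν) (hg : Tendsto g atTop (𝓝 g₀)) {a : ℝ≥0∞}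
    (ha : Tendsto (fun n => ∫⁻ x, Φ x (g n x) ∂ν) atTop (𝓝 a)) :
    ∫⁻ x, Φ x (g₀ x) ∂ν ≤ a := by
  obtain ⟨φ, hφ, hae⟩ := (tendstoInMeasure_of_tendsto_Lp hg).exists_seq_tendsto_ae
  calc ∫⁻ x, Φ x (g₀ x) ∂ν = ∫⁻ x, liminf (fun n => Φ x (g (φ n) x)) atTop ∂ν := by
        refine lintegral_congr_ae ?_
        filter_upwards [hνμ.ae_le hae] with x hx
        exact ((((hΦ x).tendsto _).comp hx).liminf_eq).symm
    _ ≤ liminf (fun n => ∫⁻ x, Φ x (g (φ n) x) ∂ν) atTop := lintegral_liminf_le' fun n => hm _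
    _ = a := (ha.comp hφ.tendsto_atTop).liminf_eq

/-- Strict convexity of the power is available only on `[0, ∞)`, hence for `|p| ≠ |q|`; if the
absolute values agree, then `p = -q ≠ 0` and the left side is 0. -/
theorem abs_midpoint_rpow_lt {t : ℝ} (ht : 1 < t) {p q : ℝ} (hpq : p ≠ q) :
    |2⁻¹ * (p + q)| ^ t < 2⁻¹ * (|p| ^ t + |q| ^ t) := by
  have ht0 : 0 < t := one_pos.trans ht
  have htri : |2⁻¹ * (p + q)| ≤ 2⁻¹ * (|p| + |q|) := by
    rw [abs_mul, abs_of_pos (by norm_num : (0 : ℝ) < 2⁻¹)]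
    gcongr
    exact abs_add_le p q
  by_cases h : |p| = |q|
  · have hpq' : p = -q := (abs_eq_abs.1 h).resolve_left hpq
    have hq : q ≠ 0 := by
      rintro rfl
      exact hpq (by simpa using hpq')
    have : 0 < |q| ^ t := Real.rpow_pos_of_pos (abs_pos.2 hq) t
    rw [hpq', neg_add_cancel, mul_zero, abs_zero, Real.zero_rpow ht0.ne', abs_neg]
    positivity
  · have h1 := (strictConvexOn_rpow ht).2 (abs_nonneg p) (abs_nonneg q) h
      (by norm_num : (0 : ℝ) < 2⁻¹) (by norm_num : (0 : ℝ) < 2⁻¹) (by norm_num)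
    simp only [smul_eq_mul] at h1
    refine lt_of_le_of_lt (Real.rpow_le_rpow (abs_nonneg _) htri ht0.le) ?_
    rw [mul_add, mul_add]
    exact h1

theorem ofReal_abs_midpoint_rpow_le {t : ℝ} (ht : 1 < t) (p q : ℝ) :
    ENNReal.ofReal (|2⁻¹ * (p + q)| ^ t) ≤
      2⁻¹ * (ENNReal.ofReal (|p| ^ t) + ENNReal.ofReal (|q| ^ t)) := by
  have h2 : (2⁻¹ : ℝ≥0∞) = ENNReal.ofReal 2⁻¹ := by
    rw [ENNReal.ofReal_inv_of_pos two_pos]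
    simp
  rw [← ENNReal.ofReal_add (by positivity) (by positivity), h2, ← ENNReal.ofReal_mul (by norm_num)]
  refine ENNReal.ofReal_le_ofReal ?_
  by_cases h : p = q
  · rw [h, ← two_mul, ← two_mul, inv_mul_cancel_left₀ two_ne_zero,
      inv_mul_cancel_left₀ two_ne_zero]
  · exact (abs_midpoint_rpow_lt ht h).le

theorem eq_of_ofReal_abs_midpoint_rpow_eq {t : ℝ} (ht : 1 < t) {p q : ℝ}
    (h : ENNReal.ofReal (|2⁻¹ * (p + q)| ^ t) =
      2⁻¹ * (ENNReal.ofReal (|p| ^ t) + ENNReal.ofReal (|q| ^ t))) : p = q := by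
  have h2 : (2⁻¹ : ℝ≥0∞) = ENNReal.ofReal 2⁻¹ := by
    rw [ENNReal.ofReal_inv_of_pos two_pos]
    simp
  rw [← ENNReal.ofReal_add (by positivity) (by positivity), h2, ← ENNReal.ofReal_mul (by norm_num),
    ENNReal.ofReal_eq_ofReal_iff (by positivity) (by positivity)] at h
  by_contra hpq
  exact (abs_midpoint_rpow_lt ht hpq).ne h

variable {Ω K : Set Plane} {t lam : ℝ} {f : Plane → ℝ}

/-- The Dirichlet integral of a Sobolev function with respect to a tensor field. -/
noncomputable def TensorField.dirichlet (A : TensorField Ω) (v : W12 Ω) : ℝ≥0∞ :=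
  ∫⁻ x in Ω, ENNReal.ofReal (A.form x (v.grad x))

/-- The fidelity term of the energy. -/
noncomputable def W12.fidelity (K : Set Plane) (t : ℝ) (f : Plane → ℝ) (v : W12 Ω) : ℝ≥0∞ :=
  ∫⁻ x in K, ENNReal.ofReal (|v.val x - f x| ^ t)

/-- The energy for a fixed tensor field. -/
noncomputable def TensorField.energy (K : Set Plane) (t lam : ℝ) (f : Plane → ℝ)
    (A : TensorField Ω) (v : W12 Ω) : ℝ≥0∞ :=
  1 / 2 * A.dirichlet v + ENNReal.ofReal lam * v.fidelity K t f

/-- The gradient as a continuous linear map. -/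
noncomputable def W12.gradL (Ω : Set Plane) : W12 Ω →L[ℝ] Lp Plane 2 (volume.restrict Ω) :=
  (WithLp.sndL 2 ℝ (Lp ℝ 2 (volume.restrict Ω)) (Lp Plane 2 (volume.restrict Ω))).comp
    (sobolevSubmodule Ω).subtypeL

/-- The underlying function as a continuous linear map. -/
noncomputable def W12.valL (Ω : Set Plane) : W12 Ω →L[ℝ] Lp ℝ 2 (volume.restrict Ω) :=
  (WithLp.fstL 2 ℝ (Lp ℝ 2 (volume.restrict Ω)) (Lp Plane 2 (volume.restrict Ω))).comp
    (sobolevSubmodule Ω).subtypeL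

theorem W12.gradL_apply (v : W12 Ω) : W12.gradL Ω v = v.grad := rfl

theorem TensorField.aemeasurable_dirichlet (hΩ : MeasurableSet Ω) (A : TensorField Ω)
    (g : Lp Plane 2 (volume.restrict Ω)) :
    AEMeasurable (fun x => ENNReal.ofReal (A.form x (g x))) (volume.restrict Ω) :=
  (A.aemeasurable_form hΩ (Lp.aestronglyMeasurable g)).ennreal_ofReal

theorem W12.aemeasurable_fidelity (hKΩ : K ⊆ Ω) (hf : AEStronglyMeasurable f (volume.restrict K))
    (g : Lp ℝ 2 (volume.restrict Ω)) :
    AEMeasurable (fun x => ENNReal.ofReal (|g x - f x| ^ t)) (volume.restrict K) := by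
  have h1 : AEMeasurable g (volume.restrict K) :=
    ((Lp.aestronglyMeasurable g).mono_measure (Measure.restrict_mono hKΩ le_rfl)).aemeasurable
  have h2 : AEMeasurable (fun x => |g x - f x|) (volume.restrict K) :=
    continuous_abs.measurable.comp_aemeasurable (h1.sub hf.aemeasurable)
  exact (h2.pow_const t).ennreal_ofReal

theorem ofReal_add_ofReal_eq_half {a b c d : ℝ} (ha : 0 ≤ a) (hb : 0 ≤ b) (hc : 0 ≤ c) (hd : 0 ≤ d)
    (h : a + b = 2⁻¹ * (c + d)) : ENNReal.ofReal a + ENNReal.ofReal b =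
      2⁻¹ * (ENNReal.ofReal c + ENNReal.ofReal d) := by
  have h2 : (2⁻¹ : ℝ≥0∞) = ENNReal.ofReal 2⁻¹ := by
    rw [ENNReal.ofReal_inv_of_pos two_pos]
    simp
  rw [← ENNReal.ofReal_add ha hb, ← ENNReal.ofReal_add hc hd, h2, ← ENNReal.ofReal_mul (by norm_num),
    h]

theorem TensorField.dirichlet_parallelogram (hΩ : MeasurableSet Ω) (A : TensorField Ω)
    (u v : W12 Ω) : A.dirichlet ((2⁻¹ : ℝ) • (u + v)) + A.dirichlet ((2⁻¹ : ℝ) • (u - v)) =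
      2⁻¹ * (A.dirichlet u + A.dirichlet v) := by
  simp only [TensorField.dirichlet, W12.grad_smul, W12.grad_add, W12.grad_sub]
  rw [← lintegral_add_left' (A.aemeasurable_dirichlet hΩ _),
    ← lintegral_add_left' (A.aemeasurable_dirichlet hΩ _), ← lintegral_const_mul' _ _ (by simp)]
  refine lintegral_congr_ae ?_
  filter_upwards [Lp.coeFn_smul (2⁻¹ : ℝ) (u.grad + v.grad), Lp.coeFn_add u.grad v.grad,
    Lp.coeFn_smul (2⁻¹ : ℝ) (u.grad - v.grad), Lp.coeFn_sub u.grad v.grad,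
    ae_restrict_mem hΩ] with x h1 h2 h3 h4 hx
  have hx' := subset_closure hx
  rw [h1, h3, Pi.smul_apply, Pi.smul_apply, h2, h4, Pi.add_apply, Pi.sub_apply]
  exact ofReal_add_ofReal_eq_half (A.form_nonneg hx' _) (A.form_nonneg hx' _)
    (A.form_nonneg hx' _) (A.form_nonneg hx' _) (A.form_parallelogram _ _ _)

theorem TensorField.ofReal_le_dirichlet (hΩ : MeasurableSet Ω) (A : TensorField Ω) {κ : ℝ}
    (hκ : 0 ≤ κ) (hA : ∀ x ∈ closure Ω, ∀ ξ : Plane, κ * ‖ξ‖ ^ 2 ≤ A.form x ξ) (v : W12 Ω) :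
    ENNReal.ofReal (κ * ‖v.grad‖ ^ 2) ≤ A.dirichlet v := by
  have h1 : ENNReal.ofReal (κ * ‖v.grad‖ ^ 2) =
      ∫⁻ x in Ω, ENNReal.ofReal κ * ‖v.grad x‖ₑ ^ 2 := by
    rw [lintegral_const_mul' _ _ ENNReal.ofReal_ne_top, ← eLpNorm_two_sq, ← Lp.enorm_def,
      ENNReal.ofReal_mul hκ, ENNReal.ofReal_pow (norm_nonneg _), ofReal_norm]
  rw [h1]
  refine setLIntegral_mono_ae' hΩ (Eventually.of_forall fun x hx => ?_)
  rw [← ofReal_norm, ← ENNReal.ofReal_pow (norm_nonneg _), ← ENNReal.ofReal_mul hκ]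
  exact ENNReal.ofReal_le_ofReal (hA x (subset_closure hx) _)

theorem W12.val_midpoint (u v : W12 Ω) : ∀ᵐ x ∂(volume.restrict Ω),
    ((2⁻¹ : ℝ) • (u + v)).val x = 2⁻¹ * (u.val x + v.val x) := by
  rw [W12.val_smul, W12.val_add]
  filter_upwards [Lp.coeFn_smul (2⁻¹ : ℝ) (u.val + v.val), Lp.coeFn_add u.val v.val] with x h1 h2
  rw [h1, Pi.smul_apply, h2, Pi.add_apply, smul_eq_mul]

theorem W12.ae_fidelity_midpoint_le (hKΩ : K ⊆ Ω) (ht : 1 < t) (u v : W12 Ω) :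
    ∀ᵐ x ∂(volume.restrict K), ENNReal.ofReal (|((2⁻¹ : ℝ) • (u + v)).val x - f x| ^ t) ≤
      2⁻¹ * (ENNReal.ofReal (|u.val x - f x| ^ t) + ENNReal.ofReal (|v.val x - f x| ^ t)) := by
  filter_upwards [ae_mono (Measure.restrict_mono hKΩ le_rfl) (W12.val_midpoint u v)] with x hx
  have := ofReal_abs_midpoint_rpow_le ht (u.val x - f x) (v.val x - f x)
  rw [hx]
  convert this using 4
  ring

theorem W12.half_fidelity_add (hKΩ : K ⊆ Ω) (hf : AEStronglyMeasurable f (volume.restrict K))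
    (u v : W12 Ω) : 2⁻¹ * (u.fidelity K t f + v.fidelity K t f) = ∫⁻ x in K,
      2⁻¹ * (ENNReal.ofReal (|u.val x - f x| ^ t) + ENNReal.ofReal (|v.val x - f x| ^ t)) := by
  have hu := W12.aemeasurable_fidelity (t := t) hKΩ hf u.val
  rw [lintegral_const_mul' _ _ (by simp), lintegral_add_left' hu]
  rfl

theorem W12.fidelity_midpoint_le (hKΩ : K ⊆ Ω) (hf : AEStronglyMeasurable f (volume.restrict K))
    (ht : 1 < t) (u v : W12 Ω) : ((2⁻¹ : ℝ) • (u + v)).fidelity K t f ≤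
      2⁻¹ * (u.fidelity K t f + v.fidelity K t f) := by
  rw [W12.half_fidelity_add hKΩ hf]
  exact lintegral_mono_ae (W12.ae_fidelity_midpoint_le hKΩ ht u v)

/-- The integrands obey the midpoint inequality pointwise and the integrals are finite, so equality
of integrals forces equality almost everywhere; strict convexity then identifies the values. -/
theorem W12.ae_eq_of_le_fidelity_midpoint (hKΩ : K ⊆ Ω)
    (hf : AEStronglyMeasurable f (volume.restrict K)) (ht : 1 < t) {u v : W12 Ω}
    (hu : u.fidelity K t f ≠ ⊤) (hv : v.fidelity K t f ≠ ⊤)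
    (h : 2⁻¹ * (u.fidelity K t f + v.fidelity K t f) ≤ ((2⁻¹ : ℝ) • (u + v)).fidelity K t f) :
    u.val =ᵐ[volume.restrict K] v.val := by
  have hfin : ((2⁻¹ : ℝ) • (u + v)).fidelity K t f ≠ ⊤ :=
    ne_top_of_le_ne_top (by finiteness) (W12.fidelity_midpoint_le hKΩ hf ht u v)
  rw [W12.half_fidelity_add hKΩ hf] at h
  have hu' := W12.aemeasurable_fidelity (t := t) hKΩ hf u.val
  have hv' := W12.aemeasurable_fidelity (t := t) hKΩ hf v.val
  have heq := ae_eq_of_ae_le_of_lintegral_le (W12.ae_fidelity_midpoint_le hKΩ ht u v) hfin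
    ((hu'.add hv').const_mul _) h
  filter_upwards [heq, ae_mono (Measure.restrict_mono hKΩ le_rfl) (W12.val_midpoint u v)] with x h1 h2
  rw [h2] at h1
  have h3 : 2⁻¹ * (u.val x + v.val x) - f x = 2⁻¹ * ((u.val x - f x) + (v.val x - f x)) := by ring
  rw [h3] at h1
  linarith [eq_of_ofReal_abs_midpoint_rpow_eq ht h1]

theorem fidelity_zero_eq (hKΩ : K ⊆ Ω) : (0 : W12 Ω).fidelity K t f =
    ∫⁻ x in K, ENNReal.ofReal (|f x| ^ t) := by
  refine lintegral_congr_ae ?_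
  have h0 : (0 : W12 Ω).val =ᵐ[volume.restrict Ω] 0 := Lp.coeFn_zero _ _ _
  filter_upwards [ae_mono (Measure.restrict_mono hKΩ le_rfl) h0] with x hx
  rw [hx, Pi.zero_apply, zero_sub, abs_neg]

theorem dirichlet_zero (A : TensorField Ω) : A.dirichlet 0 = 0 := by
  have h0 : (0 : W12 Ω).grad =ᵐ[volume.restrict Ω] 0 := Lp.coeFn_zero _ _ _
  rw [TensorField.dirichlet, lintegral_congr_ae (g := fun _ => 0), lintegral_zero]
  filter_upwards [h0] with x hx
  rw [hx]
  simp [TensorField.form_eq]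

theorem eLpNorm_ofReal_eq_lintegral_rpow {α : Type*} [MeasurableSpace α] {μ : Measure α} {g : α → ℝ}
    (ht : 1 < t) : eLpNorm g (ENNReal.ofReal t) μ = (∫⁻ x, ENNReal.ofReal (|g x| ^ t) ∂μ) ^ (1 / t) := by
  have ht0 : 0 < t := one_pos.trans ht
  rw [eLpNorm_eq_lintegral_rpow_enorm_toReal (ENNReal.ofReal_pos.2 ht0).ne' ENNReal.ofReal_ne_top,
    ENNReal.toReal_ofReal ht0.le]
  simp_rw [Real.enorm_eq_ofReal_abs, ENNReal.ofReal_rpow_of_nonneg (abs_nonneg _) ht0.le]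

theorem lintegral_ofReal_abs_rpow_ne_top (ht : 1 < t)
    (hf : MemLp f (ENNReal.ofReal t) (volume.restrict K)) :
    ∫⁻ x in K, ENNReal.ofReal (|f x| ^ t) ≠ ⊤ := by
  intro h
  have h1 := hf.2
  have ht0 : 0 < 1 / t := one_div_pos.2 (one_pos.trans ht)
  rw [eLpNorm_ofReal_eq_lintegral_rpow ht, h, ENNReal.top_rpow_of_pos ht0] at h1
  exact lt_irrefl _ h1

end Energy

/-! ### The energy of a fixed tensor field is coercive -/

section Minimization

open Filter Topology

variable {Ω K : Set Plane} {t lam : ℝ} {f : Plane → ℝ}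

theorem TensorField.energy_le_of_tendsto (hΩ : MeasurableSet Ω) (hKΩ : K ⊆ Ω) (ht : 1 < t)
    (hf : AEStronglyMeasurable f (volume.restrict K)) (A : TensorField Ω) {u : ℕ → W12 Ω}
    {u₀ : W12 Ω} {m : ℝ≥0∞} (hu : Tendsto u atTop (𝓝 u₀))
    (hm : Tendsto (fun n => A.energy K t lam f (u n)) atTop (𝓝 m)) :
    A.energy K t lam f u₀ ≤ m := by
  -- Since `[0, ∞]` is compact, both terms converge separately along a subsequence, and Fatou's
  -- lemma applies to each.
  obtain ⟨a, φ, hφ, ha⟩ := CompactSpace.tendsto_subseq fun n => A.dirichlet (u n)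
  obtain ⟨b, ψ, hψ, hb⟩ := CompactSpace.tendsto_subseq fun n => (u (φ n)).fidelity K t f
  have hu' : Tendsto (fun n => u (φ (ψ n))) atTop (𝓝 u₀) :=
    hu.comp (hφ.comp hψ).tendsto_atTop
  have ha' : Tendsto (fun n => A.dirichlet (u (φ (ψ n)))) atTop (𝓝 a) := ha.comp hψ.tendsto_atTop
  have hm' : Tendsto (fun n => A.energy K t lam f (u (φ (ψ n)))) atTop (𝓝 m) :=
    hm.comp (hφ.comp hψ).tendsto_atTop
  have hA : A.dirichlet u₀ ≤ a :=
    lintegral_le_of_tendsto_Lp (ν := volume.restrict Ω) (Measure.AbsolutelyContinuous.refl _)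
      (Φ := fun x ξ => ENNReal.ofReal (A.form x ξ))
      (fun x => by
        simp only [TensorField.form_eq]
        exact ENNReal.continuous_ofReal.comp (by fun_prop))
      (fun n => A.aemeasurable_dirichlet hΩ _)
      (((W12.gradL Ω).continuous.tendsto u₀).comp hu') ha'
  have ht0 : 0 ≤ t := (one_pos.trans ht).le
  have hF : u₀.fidelity K t f ≤ b :=
    lintegral_le_of_tendsto_Lp (ν := volume.restrict K)
      (Measure.restrict_mono hKΩ le_rfl).absolutelyContinuous
      (Φ := fun x s => ENNReal.ofReal (|s - f x| ^ t))
      (fun x => ENNReal.continuous_ofReal.comp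
        ((continuous_abs.comp (continuous_id.sub continuous_const)).rpow_const fun _ => Or.inr ht0))
      (fun n => W12.aemeasurable_fidelity hKΩ hf _)
      (((W12.valL Ω).continuous.tendsto u₀).comp hu') hb
  have hlim : Tendsto (fun n => A.energy K t lam f (u (φ (ψ n)))) atTop
      (𝓝 (1 / 2 * a + ENNReal.ofReal lam * b)) :=
    (ENNReal.Tendsto.const_mul ha' (Or.inr (by simp))).add
      (ENNReal.Tendsto.const_mul hb (Or.inr ENNReal.ofReal_ne_top))
  rw [tendsto_nhds_unique hm' hlim, TensorField.energy]
  gcongr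

/-- The parallelogram law leaves half the Dirichlet integral of `(u - v) / 2` to spare; ellipticity
bounds it below with factor `1/2 * κ * 1/4 = κ / 8`. -/
theorem TensorField.energy_midpoint_add_le (hΩ : MeasurableSet Ω) (hKΩ : K ⊆ Ω) (ht : 1 < t)
    (hf : AEStronglyMeasurable f (volume.restrict K)) (A : TensorField Ω) {κ : ℝ}
    (hκ : 0 ≤ κ) (hA : ∀ x ∈ closure Ω, ∀ ξ : Plane, κ * ‖ξ‖ ^ 2 ≤ A.form x ξ) (u v : W12 Ω) :
    A.energy K t lam f ((2⁻¹ : ℝ) • (u + v)) +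
      ENNReal.ofReal (κ / 8 * ‖W12.gradL Ω (u - v)‖ ^ 2) ≤
      2⁻¹ * (A.energy K t lam f u + A.energy K t lam f v) := by
  have h1 : ENNReal.ofReal (κ / 8 * ‖W12.gradL Ω (u - v)‖ ^ 2) ≤
      1 / 2 * A.dirichlet ((2⁻¹ : ℝ) • (u - v)) := by
    have h2 := A.ofReal_le_dirichlet hΩ hκ hA ((2⁻¹ : ℝ) • (u - v))
    have h3 : κ / 8 * ‖W12.gradL Ω (u - v)‖ ^ 2 =
        1 / 2 * (κ * ‖((2⁻¹ : ℝ) • (u - v)).grad‖ ^ 2) := by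
      rw [W12.grad_smul, norm_smul, W12.gradL_apply, mul_pow]
      norm_num
      ring
    rw [h3, ENNReal.ofReal_mul (by norm_num)]
    have h4 : ENNReal.ofReal (1 / 2) = 1 / 2 := by
      rw [ENNReal.ofReal_div_of_pos two_pos]
      simp
    rw [h4]
    gcongr
  have h5 := A.dirichlet_parallelogram hΩ u v
  have h6 := W12.fidelity_midpoint_le hKΩ hf ht u v
  calc A.energy K t lam f ((2⁻¹ : ℝ) • (u + v)) + ENNReal.ofReal (κ / 8 * ‖W12.gradL Ω (u - v)‖ ^ 2)
      ≤ 1 / 2 * A.dirichlet ((2⁻¹ : ℝ) • (u + v)) +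
        ENNReal.ofReal lam * (2⁻¹ * (u.fidelity K t f + v.fidelity K t f)) +
        1 / 2 * A.dirichlet ((2⁻¹ : ℝ) • (u - v)) := by
        rw [TensorField.energy]
        gcongr
    _ = 1 / 2 * (A.dirichlet ((2⁻¹ : ℝ) • (u + v)) + A.dirichlet ((2⁻¹ : ℝ) • (u - v))) +
        ENNReal.ofReal lam * (2⁻¹ * (u.fidelity K t f + v.fidelity K t f)) := by ring
    _ = _ := by
        rw [h5, TensorField.energy, TensorField.energy]
        ring

theorem W12.ae_val_eq_of_eq_sub_smul {e : W12 Ω} (he : e.val =ᵐ[volume.restrict Ω] fun _ => 1)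
    {v b : W12 Ω} {c : ℝ} (hb : b = v - c • e) :
    ∀ᵐ x ∂(volume.restrict Ω), b.val x = v.val x - c := by
  have hbval : b.val = v.val - c • e.val := by rw [hb, W12.val_sub, W12.val_smul]
  rw [hbval]
  filter_upwards [Lp.coeFn_sub v.val (c • e.val), Lp.coeFn_smul c e.val, he] with x h1 h2 h3
  rw [h1, Pi.sub_apply, h2, Pi.smul_apply, h3, smul_eq_mul, mul_one]

theorem W12.ae_ofReal_abs_le (hKΩ : K ⊆ Ω) {e : W12 Ω}
    (he : e.val =ᵐ[volume.restrict Ω] fun _ => 1) (v : W12 Ω) {b : W12 Ω} {c : ℝ}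
    (hb : b = v - c • e) : ∀ᵐ x ∂(volume.restrict K), ENNReal.ofReal |c| ≤
      ENNReal.ofReal |v.val x - f x| + ENNReal.ofReal |f x| + ENNReal.ofReal |b.val x| := by
  filter_upwards [ae_mono (Measure.restrict_mono hKΩ le_rfl) (W12.ae_val_eq_of_eq_sub_smul he hb)]
    with x hx
  rw [← ENNReal.ofReal_add (abs_nonneg _) (abs_nonneg _),
    ← ENNReal.ofReal_add (by positivity) (abs_nonneg _)]
  refine ENNReal.ofReal_le_ofReal ?_
  have h4 : c = (v.val x - f x) + f x - b.val x := by rw [hx]; ring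
  calc |c| = |(v.val x - f x) + f x - b.val x| := by rw [← h4]
    _ ≤ |(v.val x - f x) + f x| + |b.val x| := abs_sub _ _
    _ ≤ _ := by gcongr; exact abs_add_le _ _

/-- With zero gradient, `u - v` is a multiple of the constant function `e`, and agreement on a set
of positive measure forces the multiple to be 0. -/
theorem W12.eq_of_gradL_sub_eq_zero (hKΩ : K ⊆ Ω) (hK_pos : 0 < volume K) {e : W12 Ω}
    (he : e.val =ᵐ[volume.restrict Ω] fun _ => 1) {ℓ : W12 Ω →L[ℝ] ℝ} {C : ℝ}
    (hℓ : ∀ v : W12 Ω, ‖v - ℓ v • e‖ ≤ C * ‖W12.gradL Ω v‖) {u v : W12 Ω}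
    (hg : W12.gradL Ω (u - v) = 0) (hae : u.val =ᵐ[volume.restrict K] v.val) : u = v := by
  have hw := hℓ (u - v)
  rw [hg, norm_zero, mul_zero] at hw
  generalize ℓ (u - v) = c at hw
  have hw' : u - v = c • e := sub_eq_zero.1 (norm_le_zero_iff.1 hw)
  have hv : v = u - c • e := by rw [← hw', sub_sub_cancel]
  have hK0 : volume.restrict K ≠ 0 := by
    rw [Ne, Measure.restrict_eq_zero]
    exact hK_pos.ne'
  have : NeBot (ae (volume.restrict K)) := ae_neBot.2 hK0
  have hzero : ∀ᵐ x ∂(volume.restrict K), c = 0 := by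
    filter_upwards [hae, ae_mono (Measure.restrict_mono hKΩ le_rfl)
      (W12.ae_val_eq_of_eq_sub_smul he hv)] with x h1 h2
    linarith
  rw [hzero.exists.choose_spec, zero_smul] at hw'
  exact sub_eq_zero.1 hw'

theorem TensorField.energy_midpoint_lt (hΩ : MeasurableSet Ω) (hKΩ : K ⊆ Ω)
    (hK_pos : 0 < volume K) (ht : 1 < t) (hlam : 0 < lam)
    (hf : AEStronglyMeasurable f (volume.restrict K)) (A : TensorField Ω) {κ : ℝ}
    (hκ : 0 < κ) (hA : ∀ x ∈ closure Ω, ∀ ξ : Plane, κ * ‖ξ‖ ^ 2 ≤ A.form x ξ) {e : W12 Ω}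
    (he : e.val =ᵐ[volume.restrict Ω] fun _ => 1) {ℓ : W12 Ω →L[ℝ] ℝ} {C : ℝ}
    (hℓ : ∀ v : W12 Ω, ‖v - ℓ v • e‖ ≤ C * ‖W12.gradL Ω v‖) {u v : W12 Ω} (huv : u ≠ v)
    (hu : A.energy K t lam f u ≠ ⊤) (hv : A.energy K t lam f v ≠ ⊤) :
    A.energy K t lam f ((2⁻¹ : ℝ) • (u + v)) <
      2⁻¹ * (A.energy K t lam f u + A.energy K t lam f v) := by
  have hle := A.energy_midpoint_add_le (lam := lam) hΩ hKΩ ht hf hκ.le hA u v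
  have hfin : 2⁻¹ * (A.energy K t lam f u + A.energy K t lam f v) ≠ ⊤ := by finiteness
  have hmid : A.energy K t lam f ((2⁻¹ : ℝ) • (u + v)) ≠ ⊤ :=
    ne_top_of_le_ne_top hfin (le_self_add.trans hle)
  -- Different gradients make the Dirichlet gap strict. For equal gradients the strictness must come
  -- from the fidelity term.
  by_cases hg : W12.gradL Ω (u - v) = 0
  · have hlam0 : ENNReal.ofReal lam ≠ 0 := (ENNReal.ofReal_pos.2 hlam).ne'
    have hfid : ∀ w : W12 Ω, A.energy K t lam f w ≠ ⊤ → A.dirichlet w ≠ ⊤ ∧ w.fidelity K t f ≠ ⊤ := by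
      intro w hw
      rw [TensorField.energy, ENNReal.add_ne_top] at hw
      exact ⟨fun h => hw.1 (by rw [h]; exact ENNReal.mul_top (by simp)),
        fun h => hw.2 (by rw [h]; exact ENNReal.mul_top hlam0)⟩
    have hlt : ((2⁻¹ : ℝ) • (u + v)).fidelity K t f <
        2⁻¹ * (u.fidelity K t f + v.fidelity K t f) := by
      by_contra! hcon
      have hae := W12.ae_eq_of_le_fidelity_midpoint hKΩ hf ht (hfid u hu).2 (hfid v hv).2 hcon
      exact huv (W12.eq_of_gradL_sub_eq_zero hKΩ hK_pos he hℓ hg hae)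
    have h5 := A.dirichlet_parallelogram hΩ u v
    have hD : 1 / 2 * A.dirichlet ((2⁻¹ : ℝ) • (u + v)) ≤
        1 / 2 * (2⁻¹ * (A.dirichlet u + A.dirichlet v)) := by
      rw [← h5]
      gcongr
      exact le_self_add
    have hDfin : 1 / 2 * A.dirichlet ((2⁻¹ : ℝ) • (u + v)) ≠ ⊤ := by
      have := (hfid _ hmid).1
      finiteness
    calc A.energy K t lam f ((2⁻¹ : ℝ) • (u + v))
        < 1 / 2 * (2⁻¹ * (A.dirichlet u + A.dirichlet v)) +
          ENNReal.ofReal lam * (2⁻¹ * (u.fidelity K t f + v.fidelity K t f)) := by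
          rw [TensorField.energy]
          exact ENNReal.add_lt_add_of_le_of_lt hDfin hD
            ((ENNReal.mul_lt_mul_iff_right hlam0 ENNReal.ofReal_ne_top).2 hlt)
      _ = _ := by
          rw [TensorField.energy, TensorField.energy]
          ring
  · refine (ENNReal.lt_add_right hmid ?_).trans_le hle
    have := norm_pos_iff.2 hg
    exact (ENNReal.ofReal_pos.2 (by positivity)).ne'

theorem ofReal_le_one_add_ofReal_rpow {t a : ℝ} (ht : 1 ≤ t) (ha : 0 ≤ a) :
    ENNReal.ofReal a ≤ 1 + ENNReal.ofReal (a ^ t) := by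
  rw [← ENNReal.ofReal_one, ← ENNReal.ofReal_add zero_le_one (by positivity)]
  refine ENNReal.ofReal_le_ofReal ?_
  by_cases h : a ≤ 1
  · have : 0 ≤ a ^ t := by positivity
    linarith
  · have := Real.self_le_rpow_of_one_le (not_le.1 h).le ht
    linarith

theorem lintegral_ofReal_abs_le_measure_add {α : Type*} [MeasurableSpace α] {μ : Measure α}
    {g : α → ℝ} (ht : 1 ≤ t) : ∫⁻ x, ENNReal.ofReal |g x| ∂μ ≤
      μ univ + ∫⁻ x, ENNReal.ofReal (|g x| ^ t) ∂μ := by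
  calc ∫⁻ x, ENNReal.ofReal |g x| ∂μ ≤ ∫⁻ x, 1 + ENNReal.ofReal (|g x| ^ t) ∂μ :=
        lintegral_mono fun x => ofReal_le_one_add_ofReal_rpow ht (abs_nonneg _)
    _ = _ := by rw [lintegral_add_left measurable_const, lintegral_one]

/-- The constant part of a Sobolev function is controlled by its energy. -/
theorem TensorField.exists_abs_le_of_energy_le (hΩ : MeasurableSet Ω) (hfin : volume Ω ≠ ⊤)
    (hKΩ : K ⊆ Ω) (hK_pos : 0 < volume K) (ht : 1 < t) (hlam : 0 < lam)
    (hf : MemLp f (ENNReal.ofReal t) (volume.restrict K)) (A : TensorField Ω) {κ : ℝ}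
    (hκ : 0 < κ) (hA : ∀ x ∈ closure Ω, ∀ ξ : Plane, κ * ‖ξ‖ ^ 2 ≤ A.form x ξ) {e : W12 Ω}
    (he : e.val =ᵐ[volume.restrict Ω] fun _ => 1) {ℓ : W12 Ω →L[ℝ] ℝ} {C : ℝ}
    (hℓ : ∀ v : W12 Ω, ‖v - ℓ v • e‖ ≤ C * ‖W12.gradL Ω v‖) {M : ℝ≥0∞} (hM : M ≠ ⊤) :
    ∃ B : ℝ, ∀ v : W12 Ω, A.energy K t lam f v ≤ M → |ℓ v| ≤ B := by
  have hlam0 : ENNReal.ofReal lam ≠ 0 := (ENNReal.ofReal_pos.2 hlam).ne'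
  have hKfin : volume K ≠ ⊤ := ne_top_of_le_ne_top hfin (measure_mono hKΩ)
  have hfI := lintegral_ofReal_abs_rpow_ne_top ht hf
  set S : ℝ := C ^ 2 * ((2 * M).toReal / κ) with hS
  -- On `K` the constant `ℓ v` is `(v - f) + f - b` with `b = v - ℓ v • e`. The three summands bound
  -- the integrals of the absolute values through `a ≤ 1 + a ^ s`, with `s = t, t, 2`, so `|ℓ v|`
  -- times the volume of `K` is at most `Q`.
  set Q : ℝ≥0∞ := (volume K + M / ENNReal.ofReal lam) +
    (volume K + ∫⁻ x in K, ENNReal.ofReal (|f x| ^ t)) + (volume K + ENNReal.ofReal S) with hQ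
  have hQfin : Q ≠ ⊤ := by
    have : M / ENNReal.ofReal lam ≠ ⊤ := ENNReal.div_ne_top hM hlam0
    finiteness
  refine ⟨(Q / volume K).toReal, fun v hv => ?_⟩
  have hdir : A.dirichlet v ≤ 2 * M := by
    have h1 : 1 / 2 * A.dirichlet v ≤ M := le_self_add.trans hv
    calc A.dirichlet v = 2 * (1 / 2 * A.dirichlet v) := by
          rw [← mul_assoc, one_div, ENNReal.mul_inv_cancel two_ne_zero (by simp), one_mul]
      _ ≤ 2 * M := by gcongr
  have hfid : v.fidelity K t f ≤ M / ENNReal.ofReal lam := by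
    rw [ENNReal.le_div_iff_mul_le (Or.inl hlam0) (Or.inl ENNReal.ofReal_ne_top), mul_comm]
    exact le_add_self.trans hv
  have hgrad : ‖v.grad‖ ^ 2 ≤ (2 * M).toReal / κ := by
    have h1 := (A.ofReal_le_dirichlet hΩ hκ.le hA v).trans hdir
    rw [ENNReal.ofReal_le_iff_le_toReal (by finiteness)] at h1
    rwa [le_div_iff₀ hκ, mul_comm]
  obtain ⟨b, hb⟩ : ∃ b, b = v - ℓ v • e := ⟨_, rfl⟩
  have hbn : ‖b.val‖ ^ 2 ≤ S := by
    have h1 : ‖b‖ ≤ C * ‖v.grad‖ := by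
      rw [hb]
      exact hℓ v
    have h2 : ‖b.val‖ ^ 2 ≤ (C * ‖v.grad‖) ^ 2 :=
      pow_le_pow_left₀ (norm_nonneg _) (b.norm_val_le.trans h1) 2
    rw [mul_pow] at h2
    exact h2.trans (mul_le_mul_of_nonneg_left hgrad (sq_nonneg C))
  have hbI : ∫⁻ x in K, ENNReal.ofReal (|b.val x| ^ (2 : ℝ)) ≤ ENNReal.ofReal S := by
    calc ∫⁻ x in K, ENNReal.ofReal (|b.val x| ^ (2 : ℝ)) = ∫⁻ x in K, ‖b.val x‖ₑ ^ 2 := by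
          refine lintegral_congr fun x => ?_
          rw [Real.enorm_eq_ofReal_abs, ← ENNReal.ofReal_pow (abs_nonneg _), Real.rpow_two]
      _ ≤ ∫⁻ x in Ω, ‖b.val x‖ₑ ^ 2 := lintegral_mono_set hKΩ
      _ = ENNReal.ofReal (‖b.val‖ ^ 2) := by
          rw [← eLpNorm_two_sq, ← Lp.enorm_def, ENNReal.ofReal_pow (norm_nonneg _), ofReal_norm]
      _ ≤ ENNReal.ofReal S := ENNReal.ofReal_le_ofReal hbn
  have hpt := W12.ae_ofReal_abs_le (f := f) hKΩ he v hb
  have hbm : AEMeasurable (fun x => ENNReal.ofReal |b.val x|) (volume.restrict K) :=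
    (continuous_abs.measurable.comp_aemeasurable ((Lp.aestronglyMeasurable b.val).mono_measure
      (Measure.restrict_mono hKΩ le_rfl)).aemeasurable).ennreal_ofReal
  have hfm : AEMeasurable (fun x => ENNReal.ofReal |f x|) (volume.restrict K) :=
    (continuous_abs.measurable.comp_aemeasurable hf.1.aemeasurable).ennreal_ofReal
  have hmain : ENNReal.ofReal |ℓ v| * volume K ≤ Q := by
    calc ENNReal.ofReal |ℓ v| * volume K = ∫⁻ _ in K, ENNReal.ofReal |ℓ v| := by
          rw [setLIntegral_const]
      _ ≤ ∫⁻ x in K, (ENNReal.ofReal |v.val x - f x| + ENNReal.ofReal |f x| +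
          ENNReal.ofReal |b.val x|) := lintegral_mono_ae hpt
      _ = (∫⁻ x in K, ENNReal.ofReal |v.val x - f x|) + (∫⁻ x in K, ENNReal.ofReal |f x|) +
          ∫⁻ x in K, ENNReal.ofReal |b.val x| := by
          rw [lintegral_add_right' _ hbm, lintegral_add_right' _ hfm]
      _ ≤ Q := by
          have hu : volume.restrict K univ = volume K := Measure.restrict_apply_univ K
          have h1 := lintegral_ofReal_abs_le_measure_add (μ := volume.restrict K)
            (g := fun x => v.val x - f x) ht.le
          have h2 := lintegral_ofReal_abs_le_measure_add (μ := volume.restrict K) (g := f) ht.le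
          have h3 := lintegral_ofReal_abs_le_measure_add (μ := volume.restrict K)
            (g := b.val) one_le_two
          rw [hu] at h1 h2 h3
          exact add_le_add (add_le_add (h1.trans (add_le_add le_rfl hfid)) h2)
            (h3.trans (add_le_add le_rfl hbI))
  have hdiv : ENNReal.ofReal |ℓ v| ≤ Q / volume K := by
    rwa [ENNReal.le_div_iff_mul_le (Or.inl hK_pos.ne') (Or.inl hKfin)]
  exact (ENNReal.ofReal_le_iff_le_toReal (ENNReal.div_ne_top hQfin hK_pos.ne')).1 hdiv

theorem TensorField.energy_zero (hKΩ : K ⊆ Ω) (A : TensorField Ω) : A.energy K t lam f 0 =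
    ENNReal.ofReal lam * ∫⁻ x in K, ENNReal.ofReal (|f x| ^ t) := by
  rw [TensorField.energy, dirichlet_zero, fidelity_zero_eq hKΩ, mul_zero, zero_add]

theorem TensorField.exists_isCoerciveEnergy (hΩ : IsBoundedLipschitzDomain Ω)
    (hKΩ : K ⊆ Ω) (hK_pos : 0 < volume K) (ht : 1 < t) (hlam : 0 < lam)
    (hf : MemLp f (ENNReal.ofReal t) (volume.restrict K)) (A : TensorField Ω) :
    ∃ (ℓ : W12 Ω →L[ℝ] ℝ) (e : W12 Ω) (κ C : ℝ),
      IsCoerciveEnergy (A.energy K t lam f) (W12.gradL Ω) ℓ e κ C := by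
  have hΩm := hΩ.isOpen.measurableSet
  obtain ⟨e, he, he'⟩ := exists_W12_eq_one hΩ.volume_ne_top
  obtain ⟨ℓ, C, hℓ⟩ := exists_norm_sub_smul_le hΩ he he'
  obtain ⟨κ, hκ, hA⟩ := A.exists_pos_mul_norm_sq_le hΩ.isBounded
  refine ⟨ℓ, e, κ / 8, C, ⟨by positivity, hℓ, ?_, ?_, ?_, ?_, ?_⟩⟩
  · exact fun u u₀ m => A.energy_le_of_tendsto hΩm hKΩ ht hf.1
  · exact A.energy_midpoint_add_le hΩm hKΩ ht hf.1 hκ.le hA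
  · exact fun u v => A.energy_midpoint_lt hΩm hKΩ hK_pos ht hlam hf.1 hκ hA he hℓ
  · exact fun M => A.exists_abs_le_of_energy_le hΩm hΩ.volume_ne_top hKΩ hK_pos ht hlam hf hκ hA he hℓ
  · refine ⟨0, ?_⟩
    rw [A.energy_zero hKΩ]
    exact ENNReal.mul_ne_top ENNReal.ofReal_ne_top (lintegral_ofReal_abs_rpow_ne_top ht hf)

end Minimization

/-! ### Continuity of the minimizer, the a priori bound and the fixed point -/

section FixedPoint

open Filter Topology

variable {Ω K : Set Plane} {t lam : ℝ} {f : Plane → ℝ}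

theorem TensorField.energy_le_mul {A A' : TensorField Ω} {c : ℝ} (hΩ : MeasurableSet Ω)
    (hc : 1 ≤ c) (h : ∀ x ∈ closure Ω, ∀ ξ : Plane, A.form x ξ ≤ c * A'.form x ξ) (v : W12 Ω) :
    A.energy K t lam f v ≤ ENNReal.ofReal c * A'.energy K t lam f v := by
  have hc0 : 0 ≤ c := zero_le_one.trans hc
  have hD : A.dirichlet v ≤ ENNReal.ofReal c * A'.dirichlet v := by
    rw [TensorField.dirichlet, TensorField.dirichlet,
      ← lintegral_const_mul' _ _ ENNReal.ofReal_ne_top]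
    refine setLIntegral_mono_ae' hΩ (Eventually.of_forall fun x hx => ?_)
    rw [← ENNReal.ofReal_mul hc0]
    exact ENNReal.ofReal_le_ofReal (h x (subset_closure hx) _)
  have hF : v.fidelity K t f ≤ ENNReal.ofReal c * v.fidelity K t f :=
    le_mul_of_one_le_left (zero_le) (by simpa using ENNReal.ofReal_le_ofReal hc)
  calc A.energy K t lam f v ≤ 1 / 2 * (ENNReal.ofReal c * A'.dirichlet v) +
        ENNReal.ofReal lam * (ENNReal.ofReal c * v.fidelity K t f) := by
        rw [TensorField.energy]
        gcongr
    _ = _ := by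
        rw [TensorField.energy]
        ring

/-- Minimizers of the energy depend continuously on the tensor field. -/
theorem continuous_minimizer (hΩ : IsBoundedLipschitzDomain Ω)
    (hKΩ : K ⊆ Ω) (hK_pos : 0 < volume K) (ht : 1 < t) (hlam : 0 < lam)
    (hf : MemLp f (ENNReal.ofReal t) (volume.restrict K)) {S : TensorField Ω → W12 Ω}
    (hS : ∀ (A : TensorField Ω) (v : W12 Ω), A.energy K t lam f (S A) ≤ A.energy K t lam f v) : Continuous S := by
  rw [continuous_iff_continuousAt]
  intro A
  rw [ContinuousAt, Metric.tendsto_nhds]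
  intro ε hε
  obtain ⟨ℓ, e, κ, C, h⟩ := A.exists_isCoerciveEnergy hΩ hKΩ hK_pos ht hlam hf
  obtain ⟨m, hm, hdist⟩ := h.exists_forall_dist_lt (hS A) hε
  -- The factor `c` is lost twice, in passing from `A` to `A'` and back, so `c ^ 2` times the
  -- minimal energy must stay below `m`; this holds for `c` near 1.
  obtain ⟨c, hcm, hc⟩ : ∃ c : ℝ,
      ENNReal.ofReal c * (ENNReal.ofReal c * A.energy K t lam f (S A)) < m ∧ 1 < c := by
    have hfin : A.energy K t lam f (S A) ≠ ⊤ := hm.ne_top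
    have hlim : Tendsto (fun c : ℝ => ENNReal.ofReal c *
        (ENNReal.ofReal c * A.energy K t lam f (S A))) (𝓝[>] 1) (𝓝 (A.energy K t lam f (S A))) := by
      have h1 : Tendsto ENNReal.ofReal (𝓝[>] 1) (𝓝 1) := by
        have := (ENNReal.continuous_ofReal.tendsto 1).mono_left (nhdsWithin_le_nhds (s := Ioi 1))
        rwa [ENNReal.ofReal_one] at this
      have h2 := ENNReal.Tendsto.mul h1 (Or.inl one_ne_zero)
        (ENNReal.Tendsto.mul_const (b := A.energy K t lam f (S A)) h1 (Or.inl one_ne_zero))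
        (Or.inr ENNReal.one_ne_top)
      simpa using h2
    exact ((hlim.eventually_lt_const hm).and self_mem_nhdsWithin).exists
  have hΩm := hΩ.isOpen.measurableSet
  filter_upwards [A.eventually_form_le hΩ.isBounded hc] with A' hA'
  refine hdist _ (le_trans ?_ hcm.le)
  calc A.energy K t lam f (S A') ≤ ENNReal.ofReal c * A'.energy K t lam f (S A') :=
        TensorField.energy_le_mul hΩm hc.le (fun x hx ξ => (hA' x hx ξ).1) _
    _ ≤ ENNReal.ofReal c * A'.energy K t lam f (S A) := by
        gcongr
        exact hS A' _
    _ ≤ ENNReal.ofReal c * (ENNReal.ofReal c * A.energy K t lam f (S A)) := by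
        gcongr
        exact TensorField.energy_le_mul hΩm hc.le (fun x hx ξ => (hA' x hx ξ).2) _

theorem aestronglyMeasurable_val (hKΩ : K ⊆ Ω) (v : W12 Ω) :
    AEStronglyMeasurable v.val (volume.restrict K) :=
  (Lp.aestronglyMeasurable v.val).mono_measure (Measure.restrict_mono hKΩ le_rfl)

/-- The a priori bound for minimizers. -/
theorem eLpNorm_le_of_energy_le_zero (hKΩ : K ⊆ Ω) (ht : 1 < t) (hlam : 0 < lam)
    (hf : MemLp f (ENNReal.ofReal t) (volume.restrict K)) {A : TensorField Ω} {u : W12 Ω}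
    (hu : A.energy K t lam f u ≤ A.energy K t lam f 0) :
    eLpNorm u.val (ENNReal.ofReal t) (volume.restrict K) ≤
      2 * eLpNorm f (ENNReal.ofReal t) (volume.restrict K) := by
  -- At 0 the energy is pure fidelity, so dropping the Dirichlet term of `u` gives a bound
  -- independent of `A`.
  have h1 : u.fidelity K t f ≤ ∫⁻ x in K, ENNReal.ofReal (|f x| ^ t) := by
    rw [A.energy_zero hKΩ] at hu
    exact (ENNReal.mul_le_mul_iff_right (ENNReal.ofReal_pos.2 hlam).ne' ENNReal.ofReal_ne_top).1
      (le_add_self.trans hu)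
  have h2 : eLpNorm (fun x => u.val x - f x) (ENNReal.ofReal t) (volume.restrict K) ≤
      eLpNorm f (ENNReal.ofReal t) (volume.restrict K) := by
    rw [eLpNorm_ofReal_eq_lintegral_rpow ht, eLpNorm_ofReal_eq_lintegral_rpow ht]
    exact ENNReal.rpow_le_rpow h1 (one_div_pos.2 (one_pos.trans ht)).le
  have h3 : (u.val : Plane → ℝ) = (fun x => u.val x - f x) + f := by
    ext x
    simp
  have ht1 : 1 ≤ ENNReal.ofReal t := by simpa using ENNReal.ofReal_le_ofReal ht.le
  calc eLpNorm u.val (ENNReal.ofReal t) (volume.restrict K)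
      = eLpNorm ((fun x => u.val x - f x) + f) (ENNReal.ofReal t) (volume.restrict K) := by rw [← h3]
    _ ≤ eLpNorm (fun x => u.val x - f x) (ENNReal.ofReal t) (volume.restrict K) +
        eLpNorm f (ENNReal.ofReal t) (volume.restrict K) :=
        eLpNorm_add_le ((aestronglyMeasurable_val hKΩ u).sub hf.1) hf.1 ht1
    _ ≤ 2 * eLpNorm f (ENNReal.ofReal t) (volume.restrict K) := by
        rw [two_mul]
        gcongr

theorem convex_dataBall (hKΩ : K ⊆ Ω) (ht : 1 < t) (R : ℝ) : Convex ℝ (dataBall Ω K t R) := by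
  have ht1 : 1 ≤ ENNReal.ofReal t := by simpa using ENNReal.ofReal_le_ofReal ht.le
  intro u hu v hv a b ha hb hab
  have hu' : eLpNorm u.val (ENNReal.ofReal t) (volume.restrict K) ≤ ENNReal.ofReal R := hu
  have hv' : eLpNorm v.val (ENNReal.ofReal t) (volume.restrict K) ≤ ENNReal.ofReal R := hv
  have hae : (a • u + b • v).val =ᵐ[volume.restrict K]
      a • (u.val : Plane → ℝ) + b • (v.val : Plane → ℝ) := by
    rw [W12.val_add, W12.val_smul, W12.val_smul]
    refine (ae_mono (Measure.restrict_mono hKΩ le_rfl) : ae _ ≤ ae (volume.restrict Ω)) ?_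
    filter_upwards [Lp.coeFn_add (a • u.val) (b • v.val), Lp.coeFn_smul a u.val,
      Lp.coeFn_smul b v.val] with x h1 h2 h3
    rw [h1, Pi.add_apply, h2, h3, Pi.add_apply]
  change eLpNorm (a • u + b • v).val (ENNReal.ofReal t) (volume.restrict K) ≤ ENNReal.ofReal R
  rw [eLpNorm_congr_ae hae]
  calc eLpNorm (a • (u.val : Plane → ℝ) + b • (v.val : Plane → ℝ)) (ENNReal.ofReal t)
        (volume.restrict K)
      ≤ eLpNorm (a • (u.val : Plane → ℝ)) (ENNReal.ofReal t) (volume.restrict K) +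
        eLpNorm (b • (v.val : Plane → ℝ)) (ENNReal.ofReal t) (volume.restrict K) :=
        eLpNorm_add_le ((aestronglyMeasurable_val hKΩ u).const_smul a)
          ((aestronglyMeasurable_val hKΩ v).const_smul b) ht1
    _ ≤ ENNReal.ofReal a * ENNReal.ofReal R + ENNReal.ofReal b * ENNReal.ofReal R := by
        rw [eLpNorm_const_smul, eLpNorm_const_smul, Real.enorm_of_nonneg ha, Real.enorm_of_nonneg hb]
        gcongr
    _ = ENNReal.ofReal R := by
        rw [← add_mul, ← ENNReal.ofReal_add ha hb, hab, ENNReal.ofReal_one, one_mul]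

theorem zero_mem_dataBall (hKΩ : K ⊆ Ω) (R : ℝ) : (0 : W12 Ω) ∈ dataBall Ω K t R := by
  have h0 : (0 : W12 Ω).val =ᵐ[volume.restrict Ω] 0 := Lp.coeFn_zero _ _ _
  change eLpNorm (0 : W12 Ω).val (ENNReal.ofReal t) (volume.restrict K) ≤ ENNReal.ofReal R
  rw [eLpNorm_congr_ae (ae_mono (Measure.restrict_mono hKΩ le_rfl) h0), eLpNorm_zero]
  exact zero_le

end FixedPoint

theorem theorem3p1 {Ω K : Set Plane} (hΩ : IsBoundedLipschitzDomain Ω)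
    (hKΩ : K ⊆ Ω) (hK : NullMeasurableSet K volume) (hK_pos : 0 < volume K)
    {t lam : ℝ} (ht : 1 < t) (hlam : 0 < lam)
    {f : Plane → ℝ} (hf : MemLp f (ENNReal.ofReal t) (volume.restrict K)) :
    ∃ R₀ : ℝ, 0 < R₀ ∧ ∀ D : W12 Ω → TensorField Ω, Continuous D →
      (∀ R : ℝ, 0 < R → IsCompact (closure (D '' dataBall Ω K t R))) →
      ∃ T : W12 Ω → W12 Ω,
        (∀ w u : W12 Ω, T w = u ↔ ∀ v : W12 Ω, energy K t lam f D w u ≤ energy K t lam f D w v) ∧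
        ∀ R : ℝ, R₀ ≤ R → ∃ u ∈ dataBall Ω K t R, T u = u := by
  have hcoercive := fun A : TensorField Ω => A.exists_isCoerciveEnergy hΩ hKΩ hK_pos ht hlam hf
  have hex : ∀ A : TensorField Ω, ∃ u, ∀ v, A.energy K t lam f u ≤ A.energy K t lam f v := by
    intro A
    obtain ⟨ℓ, e, κ, C, h⟩ := hcoercive A
    exact h.exists_minimizer
  choose S hS using hex
  have hSc : Continuous S := continuous_minimizer hΩ hKΩ hK_pos ht hlam hf hS
  have hSball : ∀ A R, 2 * (eLpNorm f (ENNReal.ofReal t) (volume.restrict K)).toReal + 1 ≤ R →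
      S A ∈ dataBall Ω K t R := by
    intro A R hR
    change eLpNorm (S A).val (ENNReal.ofReal t) (volume.restrict K) ≤ ENNReal.ofReal R
    refine (eLpNorm_le_of_energy_le_zero hKΩ ht hlam hf (hS A 0)).trans ?_
    rw [ENNReal.le_ofReal_iff_toReal_le (ENNReal.mul_ne_top (by simp) hf.eLpNorm_ne_top)
      (le_trans (by positivity) hR), ENNReal.toReal_mul, ENNReal.toReal_ofNat]
    linarith
  -- The summand 1 only ensures that the radius is positive when `f` vanishes.
  refine ⟨2 * (eLpNorm f (ENNReal.ofReal t) (volume.restrict K)).toReal + 1, by positivity,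
    fun D hD hcomp => ⟨fun w => S (D w), fun w u => ⟨?_, fun hu => ?_⟩, fun R hR => ?_⟩⟩
  · rintro rfl v
    exact hS (D w) v
  · obtain ⟨ℓ, e, κ, C, h⟩ := hcoercive (D w)
    exact h.eq_of_forall_le (hS (D w)) hu
  · have hRpos : 0 < R := lt_of_lt_of_le (by positivity) hR
    have hc : IsCompact (closure ((fun w => S (D w)) '' dataBall Ω K t R)) := by
      refine ((hcomp R hRpos).image hSc).closure_of_subset ?_
      rintro _ ⟨w, hw, rfl⟩
      exact ⟨D w, subset_closure ⟨w, hw, rfl⟩, rfl⟩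
    obtain ⟨u, hu⟩ := exists_fixedPoint_of_isCompact_closure_image (hSc.comp hD)
      (convex_dataBall hKΩ ht R) ⟨0, zero_mem_dataBall hKΩ R⟩ (fun w _ => hSball (D w) R hR) hc
    refine ⟨u, ?_, hu⟩
    -- Every value of `S` lies in the data ball, hence so does the fixed point; closedness of the
    -- ball is not needed.
    have := hSball (D u) R hR
    rwa [show S (D u) = u from hu] at this
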